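/- Let $K=\mathbb{Q}(\sqrt{69})$, let $\mathcal{O}_K$ be its ring of integers, and let $\mathfrak{p}=(23,\sqrt{69})$ be the prime ideal above $23$. For a real number $c>0$ let $\phi$ be the multiplicative function on the nonzero fractional ideals of $K$ with $\phi(\mathfrak{p})=c$ and $\phi(\mathfrak{q})=N\mathfrak{q}$ for all prime ideals $\mathfrak{q}\neq\mathfrak{p}$, and let $f_{\mathfrak{p},c}:K\to\mathbb{R}_{\ge 0}$ be the weighted norm given by $f_{\mathfrak{p},c}(0)=0$ and $f_{\mathfrak{p},c}(\alpha)=\phi(\alpha\mathcal{O}_K)$ for $\alpha\ne 0$. A function $f:\mathcal{O}_K\to\mathbb{R}_{\ge 0}$ is called Euclidean if (i) $f(\mathcal{O}_K)\cap[0,t]$ is finite for every $t\ge 0$, (ii) $f(r)=0$ if and only if $r=0$, and (iii) with $\kappa=1$, for all $a,b\in\mathcal{O}_K$ with $b\ne0$ there is a $q\in\mathcal{O}_K$ with $f(a-bq)<\kappa f(b)$. The Euclidean window $w(\mathfrak{p})$ is the set of all $c>0$ for which $f_{\mathfrak{p},c}$ is Euclidean on $\mathcal{O}_K$. The Euclidean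 minimum $M_1(\mathcal{O}_K,f)\in[0,\infty]$ is the infimum of all real $\kappa$ for which the condition in (iii) holds ($\infty$ if there are none). For $\xi\in K$ let $M(\xi,f)=\inf\{\kappa\in\mathbb{R}: f(\xi-q)<\kappa\text{ for some }q\in\mathcal{O}_K\}$. The minimum $M_1=M_1(\mathcal{O}_K,f)$ is called isolated if there is a real $\kappa_2<M_1$ such that $M(\xi,f)\le\kappa_2$ for all $\xi\in K$ with $M(\xi,f)\neq M_1$. Then: 1. $w(\mathfrak{p})=(25,\infty)$. 2. For all $c\in w(\mathfrak{p})$, $$M_1(\mathcal{O}_K,f_{\mathfrak{p},c})=\max\Big\{\frac{25}{c},\ \frac{1}{23}\big(-600+75\sqrt{69}\big)\Big\}.$$ 3. In particular, $M_1(\mathcal{O}_K,f_{\mathfrak{p},c})$ is finite and irrational for all $c\ge\frac{23}{15}(8+\sqrt{69})$. 4. For real $c>0$, the minimum $M_1(\mathcal{O}_K,f_{\mathfrak{p},c})$ is isolated if and only if $c\in\big[23,\frac{23}{15}(8+\sqrt{69})\big)$. -/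

import Mathlib

open scoped NumberField nonZeroDivisors

noncomputable section

namespace EuclideanWindows

open IsDedekindDomain

section Ring

variable {R : Type*} [CommRing R]

/-- For all `a, b` with `b ≠ 0` there is a `q` with `f (a - b q) < κ f b`. -/
def DivisionBound (f : R → ℝ) (κ : ℝ) : Prop :=
  ∀ a b : R, b ≠ 0 → ∃ q : R, f (a - b * q) < κ * f b

/-- `f` is a Euclidean function on `R`, with values in the nonnegative reals. -/
structure IsEuclideanFunction (f : R → ℝ) : Prop where
  nonneg : ∀ r, 0 ≤ f r
  finite_values : ∀ t : ℝ, 0 ≤ t → (Set.range f ∩ Set.Icc 0 t).Finite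
  eq_zero_iff : ∀ r, f r = 0 ↔ r = 0
  division : DivisionBound f 1

/-- The Euclidean minimum `M(R, f)`: the infimum of all real `κ` for which `DivisionBound f κ`
holds. It is taken in the extended reals, so that it is `⊤` if there is no such `κ`. -/
def euclideanMinimum (f : R → ℝ) : EReal :=
  sInf ((fun κ : ℝ => (κ : EReal)) '' {κ : ℝ | DivisionBound f κ})

end Ring

section NumberField

variable {K : Type*} [Field K] [NumberField K]

/-- The Euclidean minimum `M(ξ, f)` at a point `ξ` of `K`: the infimum of all real `κ` such that
`f (ξ - q) < κ` for some algebraic integer `q` of `K`. -/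
def pointMinimum (f : K → ℝ) (ξ : K) : EReal :=
  sInf ((fun κ : ℝ => (κ : EReal)) '' {κ : ℝ | ∃ q : 𝓞 K, f (ξ - (q : K)) < κ})

/-- The Euclidean minimum of `𝓞 K` with respect to the restriction of `f` to `𝓞 K`. -/
def firstMinimum (f : K → ℝ) : EReal :=
  euclideanMinimum (fun a : 𝓞 K => f (a : K))

/-- The minimum `M₁ = M(𝓞 K, f)` is isolated: some real `κ₂ < M₁` bounds `M(ξ, f)` for all points
`ξ` at which `M₁` is not attained. -/
def IsIsolatedMinimum (f : K → ℝ) : Prop :=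
  ∃ κ₂ : ℝ, (κ₂ : EReal) < firstMinimum f ∧
    ∀ ξ : K, pointMinimum f ξ ≠ firstMinimum f → pointMinimum f ξ ≤ (κ₂ : EReal)

open Classical in
/-- The weight of a prime ideal `q`: its norm if `q ≠ p`, and `c` if `q = p`. -/
def primeWeight (p : HeightOneSpectrum (𝓞 K)) (c : ℝ) (q : HeightOneSpectrum (𝓞 K)) : ℝ :=
  if q = p then c else (Ideal.absNorm q.asIdeal : ℝ)

/-- The multiplicative extension of `primeWeight p c` to the nonzero fractional ideals of `K`:
the product of the prime weights to the exponents in the prime factorization of `I`. -/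
def idealWeight (p : HeightOneSpectrum (𝓞 K)) (c : ℝ) (I : FractionalIdeal (𝓞 K)⁰ K) : ℝ :=
  ∏ᶠ q : HeightOneSpectrum (𝓞 K), primeWeight p c q ^ FractionalIdeal.count K q I

open Classical in
/-- The weighted norm on `K`: zero at `0`, and the weight of the principal fractional ideal
generated by `α` if `α ≠ 0`. -/
def weightedNorm (p : HeightOneSpectrum (𝓞 K)) (c : ℝ) (α : K) : ℝ :=
  if α = 0 then 0 else idealWeight p c (FractionalIdeal.spanSingleton (𝓞 K)⁰ α)

/-- The Euclidean window of `p`: all weights `c > 0` for which the weighted norm is a Euclidean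
function on `𝓞 K`. -/
def euclideanWindow (p : HeightOneSpectrum (𝓞 K)) : Set ℝ :=
  {c : ℝ | 0 < c ∧ IsEuclideanFunction (fun a : 𝓞 K => weightedNorm p c (a : K))}

end NumberField

end EuclideanWindows

end

set_option linter.unusedSectionVars false

noncomputable section

namespace EuclideanWindows

open IsDedekindDomain

/-! Since 23 ramifies, the weighted norm of an element of norm `n` is `|n| (c/23)^v` with `v` the
23-adic valuation of `n`. By multiplicativity, the Euclidean minimum is governed by the values at
the translates `ξ - q` of points `ξ = x + y√69`, a question about the torus `K ⊗ ℝ / 𝓞 K`.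

Upper bound for `c ≥ 23`. The integers `q` for which the norm of `ξ - q` has positive valuation lie
in one residue class modulo the prime; for all others the weighted norm is at most `|N(ξ - q)|`. So
if no translate has weighted norm below `limitMinimum`, then `ξ` is exposed: `|N(ξ - q)| >
limitMinimum` for all `q` outside one class. A finite covering computation (`boxCovered_quarter`)
confines exposed points to small boxes around `0`, around `±4√69/23`, and around two points, up to
symmetry, of an orbit joining these last two fixed points of the fundamental unit `ε`. Exposedness
is invariant under `ε`, which acts hyperbolically. The connecting orbit is excluded by two explicit
translates, both of norm `limitMinimum` in absolute value at the limit point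
(`not_second_excursion`); this is the origin of the irrational constant. A point whose orbit never
leaves a small box around a fixed point is that fixed point (`eq_fixed_point`). Hence only
`±4√69/23` can have minimum at least `limitMinimum`, and there a congruence modulo 9 gives exactly
`25/c` (`center_le_normWeight`).

Lower bound for `c` past the threshold `25 / limitMinimum`. Points periodic up to sign under powers
of `ε` approximate the connecting orbit. Their translates have norm nearly `limitMinimum` or more,
except for one smaller value, which is divisible by a high power of 23 and is therefore inflated by
the weight (`exists_near_limitMinimum`). These minima approach `limitMinimum` from below, so it is
the supremum, it is not attained, and it is not isolated. Below the threshold `25/c > limitMinimum`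
is attained exactly at the centres and is isolated.

For `c < 23` negative valuations increase the weight: periodic points with a large power of 23 in
the denominator have all norms at least `1/2` in absolute value but arbitrarily large weight
(`exists_large_of_lt`). So `M₁ = ⊤`, while every point minimum is finite. -/

/-- The weight of an element of norm `n`: `|n| (c / 23) ^ v₂₃(n)`. -/
def normWeight (c : ℝ) (n : ℚ) : ℝ := |(n : ℝ)| * (c / 23) ^ padicValRat 23 n

/-! ### Coordinates on K, and the weighted norm as a function of the norm -/

section Field

variable {K : Type*} [Field K] [NumberField K]

/-- The shape `69 + 0 * r` is the one under which `QuadraticAlgebra ℚ 69 0` becomes a field; this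
gives injectivity of the map to `K` below. -/
instance fact_sqrt69 : Fact (∀ r : ℚ, r ^ 2 ≠ 69 + 0 * r) := ⟨by
  intro r h
  have h1 : IsSquare ((69 : ℕ) : ℚ) := ⟨r, by push_cast; linarith [sq r]⟩
  rw [Rat.isSquare_natCast_iff] at h1
  obtain ⟨m, hm⟩ := h1
  have : m ≤ 8 := by nlinarith
  interval_cases m <;> omega⟩

theorem exists_coords (s : 𝓞 K) (hs : s ^ 2 = 69)
    (hK : IntermediateField.adjoin ℚ {(s : K)} = ⊤) :
    ∃ e : QuadraticAlgebra ℚ 69 0 ≃ₐ[ℚ] K, ∀ x y : ℚ, e ⟨x, y⟩ = x + y * (s : K) := by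
  have hs' : (s : K) * s = (69 : ℚ) • 1 + (0 : ℚ) • (s : K) := by
    have := congrArg (algebraMap (𝓞 K) K) hs
    simp only [map_pow, map_ofNat] at this
    rw [← sq, this, Algebra.smul_def]; simp
  let φ := QuadraticAlgebra.lift (a := (69 : ℚ)) (b := 0) ⟨(s : K), hs'⟩
  have hφ : ∀ x y : ℚ, φ ⟨x, y⟩ = x + y * (s : K) := by
    intro x y
    simp [φ, QuadraticAlgebra.lift, Algebra.smul_def]
  have hbij : Function.Bijective φ := by
    refine ⟨φ.toRingHom.injective, ?_⟩
    have : (⊤ : IntermediateField ℚ K) ≤ φ.fieldRange := by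
      rw [← hK, IntermediateField.adjoin_le_iff]
      rintro _ rfl
      exact ⟨⟨0, 1⟩, by simpa using hφ 0 1⟩
    intro y
    obtain ⟨x, hx⟩ := this (show y ∈ ⊤ from trivial)
    exact ⟨x, hx⟩
  exact ⟨AlgEquiv.ofBijective φ hbij, hφ⟩

theorem exists_rat_coords (s : 𝓞 K) (hs : s ^ 2 = 69)
    (hK : IntermediateField.adjoin ℚ {(s : K)} = ⊤) (α : K) :
    ∃ x y : ℚ, α = x + y * (s : K) := by
  obtain ⟨e, he⟩ := exists_coords s hs hK
  obtain ⟨⟨x, y⟩, rfl⟩ := e.surjective α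
  exact ⟨x, y, he x y⟩

theorem norm_coords (s : 𝓞 K) (hs : s ^ 2 = 69)
    (hK : IntermediateField.adjoin ℚ {(s : K)} = ⊤) (x y : ℚ) :
    Algebra.norm ℚ (x + y * (s : K)) = x ^ 2 - 69 * y ^ 2 := by
  obtain ⟨e, he⟩ := exists_coords s hs hK
  rw [← he, Algebra.norm_eq_of_algEquiv, Algebra.norm_apply]
  refine (QuadraticAlgebra.det_toLinearMap_eq_norm (⟨x, y⟩ : QuadraticAlgebra ℚ 69 0)).trans ?_
  rw [QuadraticAlgebra.norm_def]; ring

theorem exists_int_coords (s : 𝓞 K) (hs : s ^ 2 = 69)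
    (hK : IntermediateField.adjoin ℚ {(s : K)} = ⊤) (q : 𝓞 K) :
    ∃ a b : ℤ, 2 ∣ a - b ∧ (q : K) = ((a / 2 : ℚ) : K) + ((b / 2 : ℚ) : K) * (s : K) := by
  obtain ⟨x, y, hxy⟩ := exists_rat_coords s hs hK (q : K)
  have hn : ∀ r : 𝓞 K, ∃ n : ℤ, (n : ℚ) = Algebra.norm ℚ (r : K) := fun r =>
    ⟨Algebra.norm ℤ r, Algebra.coe_norm_int r⟩
  obtain ⟨n, hn0⟩ := hn q
  obtain ⟨m, hm⟩ := hn (q + 1)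
  rw [hxy, norm_coords s hs hK] at hn0
  have e1 : ((q + 1 : 𝓞 K) : K) = ((x + 1 : ℚ) : K) + (y : K) * (s : K) := by
    change (q : K) + 1 = _
    rw [hxy]; push_cast; ring
  rw [e1, norm_coords s hs hK] at hm
  -- `N(q + 1) - N(q) - 1` is the trace `2x`, so integrality of norms alone controls `x`.
  set a : ℤ := m - n - 1 with ha
  have hx : x = a / 2 := by rw [ha]; push_cast; linarith
  have hy : 69 * (2 * y) ^ 2 = ((a ^ 2 - 4 * n : ℤ) : ℚ) := by
    push_cast; rw [hn0, hx]; ring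
  -- `69 y'^2` integral implies `y'` integral
  have key : ∃ b : ℤ, 2 * y = b := by
    set z := 2 * y
    -- `69 z` is an integer with square `69 (a² - 4n)`; as 69 is squarefree it is divisible by 69,
    -- so `z` is an integer.
    have hint : IsIntegral ℤ (69 * z) := by
      refine ⟨Polynomial.X ^ 2 - Polynomial.C (69 * (a ^ 2 - 4 * n)), Polynomial.monic_X_pow_sub_C _ two_ne_zero, ?_⟩
      simp only [Polynomial.eval₂_sub, Polynomial.eval₂_X_pow, Polynomial.eval₂_C]
      have : (69 * z) ^ 2 = 69 * (69 * z ^ 2) := by ring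
      rw [this, hy]; simp
    obtain ⟨w, hw⟩ := IsIntegrallyClosed.isIntegral_iff.mp hint
    have hw' : (w : ℚ) = 69 * z := by simpa using hw
    have h69 : w ^ 2 = 69 * (a ^ 2 - 4 * n) := by
      have : (w : ℚ) ^ 2 = 69 * ((a ^ 2 - 4 * n : ℤ) : ℚ) := by rw [hw', ← hy]; ring
      exact_mod_cast this
    have h3 : (3 : ℤ) ∣ w := Int.prime_three.dvd_of_dvd_pow (n := 2) (by rw [h69]; exact ⟨23 * (a ^ 2 - 4 * n), by ring⟩)
    have h23 : (23 : ℤ) ∣ w := (Nat.prime_iff_prime_int.mp (by norm_num : Nat.Prime 23)).dvd_of_dvd_pow (n := 2) (by rw [h69]; exact ⟨3 * (a ^ 2 - 4 * n), by push_cast; ring⟩)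
    obtain ⟨b, hb⟩ : (69 : ℤ) ∣ w := by omega
    refine ⟨b, ?_⟩
    have : (w : ℚ) = 69 * b := by rw [hb]; push_cast; ring
    linarith
  obtain ⟨b, hb⟩ := key
  refine ⟨a, b, ?_, ?_⟩
  · have h4 : 69 * b ^ 2 = a ^ 2 - 4 * n := by
      rw [hb] at hy; exact_mod_cast hy
    have h5 : (a - b) * (a + b) = 4 * (n + 17 * b ^ 2) := by linarith
    by_contra hodd
    have o1 : Odd (a - b) := by rw [← Int.not_even_iff_odd, even_iff_two_dvd]; exact hodd
    have o2 : Odd (a + b) := by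
      have : a + b = (a - b) + 2 * b := by ring
      rw [this]; exact o1.add_even (even_two_mul b)
    have := o1.mul o2
    rw [h5] at this
    exact (Int.not_even_iff_odd.mpr this) ⟨2 * (n + 17 * b ^ 2), by ring⟩
  · rw [hxy, hx, show y = b / 2 by linarith]

theorem exists_integer_of_coords (s : 𝓞 K) (hs : s ^ 2 = 69) (a b : ℤ) (hab : 2 ∣ a - b) :
    ∃ q : 𝓞 K, (q : K) = ((a / 2 : ℚ) : K) + ((b / 2 : ℚ) : K) * (s : K) := by
  have hs' : (s : K) ^ 2 = 69 := by
    have := congrArg (algebraMap (𝓞 K) K) hs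
    rwa [map_pow, map_ofNat] at this
  have hω : IsIntegral ℤ ((1 + (s : K)) / 2) := by
    refine ⟨Polynomial.X ^ 2 - (Polynomial.X + Polynomial.C 17), ?_, ?_⟩
    · monicity!
    · rw [Polynomial.eval₂_sub, Polynomial.eval₂_X_pow, Polynomial.eval₂_add, Polynomial.eval₂_X,
        Polynomial.eval₂_C, map_ofNat]
      field_simp
      linear_combination hs'
  obtain ⟨k, hk⟩ := hab
  let w : 𝓞 K := ⟨_, hω⟩
  refine ⟨(k : 𝓞 K) + (b : 𝓞 K) * w, ?_⟩
  have : a = b + 2 * k := by linarith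
  rw [this]
  trans (k : K) + (b : K) * ((1 + (s : K)) / 2)
  · push_cast
    rfl
  · push_cast
    ring

theorem coords_eq_zero (s : 𝓞 K) (hs : s ^ 2 = 69)
    (hK : IntermediateField.adjoin ℚ {(s : K)} = ⊤) {x y : ℚ} (h : (x : K) + y * (s : K) = 0) :
    x = 0 ∧ y = 0 := by
  obtain ⟨e, he⟩ := exists_coords s hs hK
  rw [← he, map_eq_zero_iff _ e.injective] at h
  exact ⟨congrArg QuadraticAlgebra.re h, congrArg QuadraticAlgebra.im h⟩

section Weight

variable (s : 𝓞 K) (hs : s ^ 2 = 69) (hK : IntermediateField.adjoin ℚ {(s : K)} = ⊤)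
  (p : HeightOneSpectrum (𝓞 K)) (hp : p.asIdeal = Ideal.span {23, s})

include hs hK hp

theorem mem_prime : (23 : 𝓞 K) ∈ p.asIdeal ∧ s ∈ p.asIdeal := by
  rw [hp]
  exact ⟨Ideal.subset_span (by simp), Ideal.subset_span (by simp)⟩

/-- The norm divides both `N(s) = -69` and `N(23) = 529`, whose gcd is the prime 23. -/
theorem absNorm_prime : Ideal.absNorm p.asIdeal = 23 := by
  obtain ⟨h23, hsm⟩ := mem_prime s hs hK p hp
  have n1 : (Algebra.norm ℤ s : ℚ) = -69 := by
    rw [Algebra.coe_norm_int]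
    have := norm_coords s hs hK 0 1
    simpa using this
  have n2 : (Algebra.norm ℤ (23 : 𝓞 K) : ℚ) = 529 := by
    rw [Algebra.coe_norm_int]
    have := norm_coords s hs hK 23 0
    simp only [Rat.cast_ofNat, Rat.cast_zero, zero_mul, add_zero] at this
    refine Eq.trans ?_ (this.trans (by norm_num))
    congr 1
  have n1' : Algebra.norm ℤ s = -69 := by exact_mod_cast n1
  have n2' : Algebra.norm ℤ (23 : 𝓞 K) = 529 := by exact_mod_cast n2
  have d1 := Ideal.absNorm_dvd_norm_of_mem hsm
  have d2 := Ideal.absNorm_dvd_norm_of_mem h23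
  rw [n1'] at d1
  rw [n2'] at d2
  have d1' : Ideal.absNorm p.asIdeal ∣ 69 := by
    have := (dvd_neg (α := ℤ)).mp d1; exact_mod_cast this
  have d2' : Ideal.absNorm p.asIdeal ∣ 529 := by exact_mod_cast d2
  have d3 : Ideal.absNorm p.asIdeal ∣ 23 := by
    have := Nat.dvd_gcd d1' d2'
    norm_num at this
    exact this
  rcases (Nat.dvd_prime (by norm_num)).mp d3 with h | h
  · exact absurd (Ideal.absNorm_eq_one_iff.mp h) p.isPrime.ne_top
  · exact h

/-- A prime above 23 contains `s`, because `s² = 3 · 23`; so 23 is ramified and `p` is the only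
prime above it. -/
theorem padicValRat_absNorm (q : HeightOneSpectrum (𝓞 K)) (hq : q ≠ p) :
    padicValRat 23 (Ideal.absNorm q.asIdeal : ℚ) = 0 := by
  have : q.asIdeal.IsMaximal := q.isMaximal
  obtain ⟨l, n, hn, hl, hlp, he⟩ := Ideal.exists_prime_and_absNorm_eq_pow q.asIdeal
  rw [padicValRat.of_nat, he, Nat.cast_eq_zero]
  apply padicValNat.eq_zero_of_not_dvd
  intro hd
  have h1 : 23 ∣ l := (show Nat.Prime 23 by norm_num).dvd_of_dvd_pow hd
  have h2 : l = 23 := ((Nat.prime_dvd_prime_iff_eq (by norm_num) hlp).mp h1).symm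
  subst h2
  have hl' : (23 : 𝓞 K) ∈ q.asIdeal := by exact_mod_cast hl
  apply hq
  have hsq : s ∈ q.asIdeal := by
    apply q.isPrime.mem_of_pow_mem 2
    rw [hs]
    have : (69 : 𝓞 K) = 3 * 23 := by norm_num
    rw [this]
    exact q.asIdeal.mul_mem_left _ hl'
  have hle : p.asIdeal ≤ q.asIdeal := by
    rw [hp, Ideal.span_le]
    rintro z (rfl | rfl)
    · exact hl'
    · exact hsq
  have := p.isMaximal
  exact HeightOneSpectrum.ext (this.eq_of_le q.isPrime.ne_top hle).symm

open FractionalIdeal in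
theorem idealWeight_eq (c : ℝ) (hc : 0 < c) (I : FractionalIdeal (𝓞 K)⁰ K) (hI : I ≠ 0) :
    idealWeight p c I = normWeight c (FractionalIdeal.absNorm I) := by
  classical
  have hfin : (Function.support fun q : HeightOneSpectrum (𝓞 K) => count K q I).Finite :=
    finite_factors I
  -- `p` is put in even when it does not divide `I`, so that its factor can always be split off.
  set S := insert p hfin.toFinset with hS
  have hne : ∀ q : HeightOneSpectrum (𝓞 K), (Ideal.absNorm q.asIdeal : ℚ) ≠ 0 := fun q => by
    simpa [Ideal.absNorm_eq_zero_iff] using q.ne_bot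
  have hnotin : ∀ q : HeightOneSpectrum (𝓞 K), q ∉ S → count K q I = 0 := by
    intro q hq
    simp only [hS, Finset.mem_insert, Set.Finite.mem_toFinset, Function.mem_support, not_or,
      not_not] at hq
    exact hq.2
  have hnorm : FractionalIdeal.absNorm I =
      ∏ q ∈ S, (Ideal.absNorm q.asIdeal : ℚ) ^ count K q I := by
    conv_lhs => rw [← finprod_heightOneSpectrum_factorization' K hI]
    rw [finprod_eq_prod_of_mulSupport_subset (s := S), map_prod]
    · refine Finset.prod_congr rfl fun q _ => ?_
      rw [map_zpow₀, coeIdeal_absNorm]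
    · intro q hq
      by_contra h
      exact hq (by simp [hnotin q h])
  have hval : ∀ T : Finset (HeightOneSpectrum (𝓞 K)),
      padicValRat 23 (∏ q ∈ T, (Ideal.absNorm q.asIdeal : ℚ) ^ count K q I) =
        if p ∈ T then count K p I else 0 := by
    intro T
    induction T using Finset.induction_on with
    | empty => simp
    | insert q T hqT ih =>
      have : Fact (Nat.Prime 23) := ⟨by norm_num⟩
      rw [Finset.prod_insert hqT, padicValRat.mul (zpow_ne_zero _ (hne q))
        (Finset.prod_ne_zero_iff.mpr fun r _ => zpow_ne_zero _ (hne r)), ih,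
        padicValRat.zpow]
      by_cases h : q = p
      · subst h
        rw [absNorm_prime s hs hK q hp]
        have : padicValRat 23 ((23 : ℕ) : ℚ) = 1 := padicValRat.self (by norm_num)
        rw [this]
        simp [hqT]
      · rw [padicValRat_absNorm s hs hK p hp q h]
        simp [Ne.symm h]
  have hw : idealWeight p c I = ∏ q ∈ S, primeWeight p c q ^ count K q I := by
    rw [idealWeight, finprod_eq_prod_of_mulSupport_subset (s := S)]
    intro q hq
    by_contra h
    exact hq (by simp [hnotin q h])
  have hpS : p ∈ S := Finset.mem_insert_self _ _
  rw [hw, normWeight, hnorm, hval, if_pos hpS, abs_of_nonneg (by positivity),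
    ← Finset.mul_prod_erase S _ hpS, ← Finset.mul_prod_erase S _ hpS]
  push_cast
  rw [absNorm_prime s hs hK p hp, primeWeight, if_pos rfl]
  have : ∏ q ∈ S.erase p, primeWeight p c q ^ count K q I =
      ∏ q ∈ S.erase p, (Ideal.absNorm q.asIdeal : ℝ) ^ count K q I := by
    refine Finset.prod_congr rfl fun q hq => ?_
    rw [primeWeight, if_neg (Finset.ne_of_mem_erase hq)]
  rw [this, mul_right_comm, ← mul_zpow]
  congr 2
  push_cast
  field_simp

theorem weightedNorm_eq (c : ℝ) (hc : 0 < c) (x y : ℚ) :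
    weightedNorm p c ((x : K) + y * (s : K)) = normWeight c (x ^ 2 - 69 * y ^ 2) := by
  by_cases h : (x : K) + y * (s : K) = 0
  · obtain ⟨rfl, rfl⟩ := coords_eq_zero s hs hK h
    simp [weightedNorm, normWeight]
  · rw [weightedNorm, if_neg h, idealWeight_eq s hs hK p hp c hc _
      (by simpa [FractionalIdeal.spanSingleton_eq_zero_iff] using h),
      FractionalIdeal.absNorm_span_singleton, norm_coords s hs hK]
    unfold normWeight
    rw [Rat.cast_abs, abs_abs]
    congr 2
    rcases abs_choice (x ^ 2 - 69 * y ^ 2) with h | h <;> rw [h]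
    exact padicValRat.neg _

end Weight

end Field

/-! ### Exposed points and the covering computation -/

/-- All integers `q = (a + b√69)/2` with `2 q ≢ t` modulo the prime above `23` have
`κ < |N(x + y√69 - q)|`. -/
def IsExposed (κ x y : ℝ) (t : ℤ) : Prop :=
  ∀ a b : ℤ, 2 ∣ a - b → ¬ (23 : ℤ) ∣ a - t → κ < |(x - a / 2) ^ 2 - 69 * (y - b / 2) ^ 2|

/-- Integers `(a + b √69) / 2` whose translates of the region `|N| ≤ 0.9998` cover. -/
def coverPoints : List (ℤ × ℤ) :=
  [(0, 0), (-2, 0), (2, 0), (-4, 0), (4, 0), (-3, 1), (-5, 1), (5, 1), (7, 1), (-11, -1), (11,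
   -1), (13, -1), (-12, 2), (14, 2), (-20, -2), (20, -2), (-21, 3), (23, 3), (25, -3), (-27,
   -3), (29, -3), (-30, 4), (30, 4), (-36, -4), (38, -4), (-46, 6), (-52, -6), (54, -6), (-55,
   7), (-61, -7), (61, -7), (63, -7), (64, 8), (-71, 9), (-77, -9), (-80, 10), (-86, -10), (86,
   -10), (89, 11), (-96, 12), (-102, -12), (-105, 13), (111, -13), (120, -14), (-127, -15),
   (-130, 16), (130, 16), (136, -16), (145, -17), (155, 19), (-277, -33), (277, -33), (-296,
   36), (302, -36), (305, 37), (-321, 39), (327, -39), (346, 42), (493, -59), (-753, 91),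
   (-1376, 166), (-1542, 186), (1548, -186), (-2140, 258), (-2146, -258), (3245, 391), (3251,
   -391)]

/-- The cover points in grid coordinates `2 ^ 20 x + 2 ^ 31`. -/
def coverGrid : List (ℕ × ℕ) :=
  coverPoints.map fun q => ((q.1 + 4096).toNat * 524288, (q.2 + 4096).toNat * 524288)

/-- The largest distance from `q` to a point of `[l, h]`. -/
def farDist (l h q : ℕ) : ℕ := bif Nat.ble (l + h) (2 * q) then q - l else h - q

/-- The smallest distance from `q` to a point of `[l, h]`. -/
def nearDist (l h q : ℕ) : ℕ := bif Nat.ble q l then l - q else q - h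

/-- The norm of `z - q` is at most `0.9998` on the whole box. -/
def boxGood (x₀ x₁ y₀ y₁ : ℕ) (q : ℕ × ℕ) : Bool :=
  Nat.ble (farDist x₀ x₁ q.1 ^ 2) (1099291722219 + 69 * nearDist y₀ y₁ q.2 ^ 2) &&
  Nat.ble (69 * farDist y₀ y₁ q.2 ^ 2) (1099291722219 + nearDist x₀ x₁ q.1 ^ 2)

/-- A necessary condition for `q` to be good on some part of the box. -/
def boxMeets (x₀ x₁ y₀ y₁ : ℕ) (q : ℕ × ℕ) : Bool :=
  Nat.ble (nearDist x₀ x₁ q.1 ^ 2) (1099291722219 + 69 * farDist y₀ y₁ q.2 ^ 2) &&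
  Nat.ble (69 * nearDist y₀ y₁ q.2 ^ 2) (1099291722219 + farDist x₀ x₁ q.1 ^ 2)

/-- The box lies in the exceptional box `e`. -/
def boxWithin (x₀ x₁ y₀ y₁ : ℕ) (e : (ℕ × ℕ) × (ℕ × ℕ)) : Bool :=
  Nat.ble (2147483648 + e.1.1) x₀ && Nat.ble x₁ (2147483648 + e.1.2) &&
  Nat.ble (2147483648 + e.2.1) y₀ && Nat.ble y₁ (2147483648 + e.2.2)

/-- Neighbourhoods of `0`, of `4√69/23`, and of two points of a heteroclinic orbit. -/
def exceptionalBoxes : List ((ℕ × ℕ) × (ℕ × ℕ)) :=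
  [((0, 8388), (0, 1048)), ((0, 5242), (181509, 183186)),
   ((5243, 12582), (182453, 184549)), ((214959, 223346), (207619, 209924))]

/-- Two of the points are incongruent modulo the prime above `23`. -/
def hasPair : List (ℕ × ℕ) → Bool
  | [] => false
  | q :: qs => qs.any fun r => ! Nat.beq ((q.1 / 524288) % 23) ((r.1 / 524288) % 23)

/-- Bisect the box until each part is exceptional or is covered by two incongruent points. -/
def boxCovered : ℕ → List (ℕ × ℕ) → ℕ → ℕ → ℕ → ℕ → Bool
  | 0, _, _, _, _, _ => false
  | n + 1, qs, x₀, x₁, y₀, y₁ =>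
    exceptionalBoxes.any (boxWithin x₀ x₁ y₀ y₁) ||
    hasPair (qs.filter (boxGood x₀ x₁ y₀ y₁)) ||
    bif Nat.ble (83 * (y₁ - y₀)) (10 * (x₁ - x₀)) then
      boxCovered n (qs.filter (boxMeets x₀ x₁ y₀ y₁)) x₀ ((x₀ + x₁) / 2) y₀ y₁ &&
      boxCovered n (qs.filter (boxMeets x₀ x₁ y₀ y₁)) ((x₀ + x₁) / 2) x₁ y₀ y₁
    else
      boxCovered n (qs.filter (boxMeets x₀ x₁ y₀ y₁)) x₀ x₁ y₀ ((y₀ + y₁) / 2) &&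
      boxCovered n (qs.filter (boxMeets x₀ x₁ y₀ y₁)) x₀ x₁ ((y₀ + y₁) / 2) y₁

/-- The grid rectangle is `0 ≤ x ≤ 1/2`, `0 ≤ y ≤ 1/4`, a fundamental domain up to translations and
the sign changes of `x` and `y`. The offset `2 ^ 31` keeps all coordinates natural. The number
`1099291722219` lies just below `0.9998 · 2 ^ 40`, and the ratio `83 : 10` in the bisection
approximates `√69`, so that boxes stay balanced for the form `x² - 69y²`. -/
theorem boxCovered_quarter :
    boxCovered 30 coverGrid 2147483648 2148007936 2147483648 2147745792 = true := by
  decide +kernel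

theorem abs_sub_le_farDist {l h q : ℕ} {X : ℝ} (hl : l ≤ X) (hh : X ≤ h) :
    |X - q| ≤ farDist l h q := by
  have hlh : l ≤ h := by exact_mod_cast hl.trans hh
  unfold farDist
  cases hb : Nat.ble (l + h) (2 * q)
  · have hlt : 2 * q < l + h := by
      by_contra hc
      rw [Nat.ble_eq_true_of_le (not_lt.mp hc)] at hb
      cases hb
    have : q ≤ h := by omega
    simp only [cond_false]
    push_cast [this]
    have h2 : (2 * q : ℝ) ≤ l + h := by exact_mod_cast hlt.le
    rw [abs_le]; constructor <;> linarith
  · have hle := Nat.le_of_ble_eq_true hb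
    have : l ≤ q := by omega
    simp only [cond_true]
    push_cast [this]
    have h2 : (l + h : ℝ) ≤ 2 * q := by exact_mod_cast hle
    rw [abs_le]; constructor <;> linarith

theorem nearDist_le_abs_sub {l h q : ℕ} {X : ℝ} (hl : l ≤ X) (hh : X ≤ h) :
    (nearDist l h q : ℝ) ≤ |X - q| := by
  unfold nearDist
  cases hb : Nat.ble q l
  · simp only [cond_false]
    rcases le_total q h with hq | hq
    · rw [Nat.sub_eq_zero_of_le hq]; simp
    · push_cast [hq]
      rw [abs_sub_comm]
      exact le_trans (by linarith) (le_abs_self _)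
  · simp only [cond_true]
    push_cast [Nat.le_of_ble_eq_true hb]
    exact le_trans (by linarith) (le_abs_self _)

theorem boxGood_sound {x₀ x₁ y₀ y₁ : ℕ} {q : ℕ × ℕ} {X Y : ℝ}
    (h : boxGood x₀ x₁ y₀ y₁ q = true) (hx₀ : x₀ ≤ X) (hx₁ : X ≤ x₁) (hy₀ : y₀ ≤ Y) (hy₁ : Y ≤ y₁) :
    |(X - q.1) ^ 2 - 69 * (Y - q.2) ^ 2| ≤ 1099291722219 := by
  rw [boxGood, Bool.and_eq_true] at h
  have h1 : ((farDist x₀ x₁ q.1 : ℝ)) ^ 2 ≤ 1099291722219 + 69 * (nearDist y₀ y₁ q.2 : ℝ) ^ 2 := by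
    exact_mod_cast Nat.le_of_ble_eq_true h.1
  have h2 : 69 * ((farDist y₀ y₁ q.2 : ℝ)) ^ 2 ≤ 1099291722219 + (nearDist x₀ x₁ q.1 : ℝ) ^ 2 := by
    exact_mod_cast Nat.le_of_ble_eq_true h.2
  have a1 := pow_le_pow_left₀ (abs_nonneg _) (abs_sub_le_farDist (q := q.1) hx₀ hx₁) 2
  have a2 := pow_le_pow_left₀ (abs_nonneg _) (abs_sub_le_farDist (q := q.2) hy₀ hy₁) 2
  have b1 := pow_le_pow_left₀ (Nat.cast_nonneg _) (nearDist_le_abs_sub (q := q.1) hx₀ hx₁) 2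
  have b2 := pow_le_pow_left₀ (Nat.cast_nonneg _) (nearDist_le_abs_sub (q := q.2) hy₀ hy₁) 2
  rw [sq_abs] at a1 a2 b1 b2
  rw [abs_le]; constructor <;> linarith

theorem boxCovered_sound (n : ℕ) : ∀ (qs : List (ℕ × ℕ)) (x₀ x₁ y₀ y₁ : ℕ) (X Y : ℝ),
    boxCovered n qs x₀ x₁ y₀ y₁ = true → x₀ ≤ X → X ≤ x₁ → y₀ ≤ Y → Y ≤ y₁ →
    (∃ e ∈ exceptionalBoxes, 2147483648 + (e.1.1 : ℝ) ≤ X ∧ X ≤ 2147483648 + (e.1.2 : ℝ) ∧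
      2147483648 + (e.2.1 : ℝ) ≤ Y ∧ Y ≤ 2147483648 + (e.2.2 : ℝ)) ∨
    ∃ q ∈ qs, ∃ r ∈ qs, (q.1 / 524288) % 23 ≠ (r.1 / 524288) % 23 ∧
      |(X - q.1) ^ 2 - 69 * (Y - q.2) ^ 2| ≤ 1099291722219 ∧
      |(X - r.1) ^ 2 - 69 * (Y - r.2) ^ 2| ≤ 1099291722219 := by
  induction n with
  | zero => intro _ _ _ _ _ _ _ h; cases h
  | succ n ih =>
    intro qs x₀ x₁ y₀ y₁ X Y h hx₀ hx₁ hy₀ hy₁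
    rw [boxCovered, Bool.or_eq_true, Bool.or_eq_true] at h
    have step : ∀ x₀ x₁ y₀ y₁ : ℕ, ∀ x₂ x₃ y₂ y₃ : ℕ,
        boxCovered n (qs.filter (boxMeets x₂ x₃ y₂ y₃)) x₀ x₁ y₀ y₁ = true →
        x₀ ≤ X → X ≤ x₁ → y₀ ≤ Y → Y ≤ y₁ → _ := fun x₀ x₁ y₀ y₁ x₂ x₃ y₂ y₃ h h1 h2 h3 h4 =>
      (ih _ x₀ x₁ y₀ y₁ X Y h h1 h2 h3 h4).imp_right fun ⟨q, hq, r, hr, h5⟩ =>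
        (⟨q, List.mem_of_mem_filter hq, r, List.mem_of_mem_filter hr, h5⟩ :
          ∃ q ∈ qs, ∃ r ∈ qs, (q.1 / 524288) % 23 ≠ (r.1 / 524288) % 23 ∧
            |(X - q.1) ^ 2 - 69 * (Y - q.2) ^ 2| ≤ 1099291722219 ∧
            |(X - r.1) ^ 2 - 69 * (Y - r.2) ^ 2| ≤ 1099291722219)
    have split : ∀ (u v : ℕ) (Z : ℝ), Z ≤ ((u + v) / 2 : ℕ) ∨ (((u + v) / 2 : ℕ) : ℝ) ≤ Z :=
      fun u v Z => le_total _ _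
    rcases h with (h | h) | h
    · left
      obtain ⟨e, he, h⟩ := List.any_eq_true.mp h
      simp only [boxWithin, Bool.and_eq_true] at h
      obtain ⟨⟨⟨h1, h2⟩, h3⟩, h4⟩ := h
      have h1 : ((2147483648 + e.1.1 : ℕ) : ℝ) ≤ x₀ := by exact_mod_cast Nat.le_of_ble_eq_true h1
      have h2 : (x₁ : ℝ) ≤ (2147483648 + e.1.2 : ℕ) := by exact_mod_cast Nat.le_of_ble_eq_true h2
      have h3 : ((2147483648 + e.2.1 : ℕ) : ℝ) ≤ y₀ := by exact_mod_cast Nat.le_of_ble_eq_true h3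
      have h4 : (y₁ : ℝ) ≤ (2147483648 + e.2.2 : ℕ) := by exact_mod_cast Nat.le_of_ble_eq_true h4
      push_cast at h1 h2 h3 h4
      exact ⟨e, he, by linarith, by linarith, by linarith, by linarith⟩
    · right
      cases hf : qs.filter (boxGood x₀ x₁ y₀ y₁) with
      | nil => rw [hf] at h; cases h
      | cons q l =>
        rw [hf, hasPair] at h
        obtain ⟨r, hr, h⟩ := List.any_eq_true.mp h
        have hq' : q ∈ qs.filter (boxGood x₀ x₁ y₀ y₁) := by rw [hf]; exact List.mem_cons_self
        have hr' : r ∈ qs.filter (boxGood x₀ x₁ y₀ y₁) := by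
          rw [hf]; exact List.mem_cons_of_mem _ hr
        rw [List.mem_filter] at hq' hr'
        refine ⟨q, hq'.1, r, hr'.1, ?_, boxGood_sound hq'.2 hx₀ hx₁ hy₀ hy₁,
          boxGood_sound hr'.2 hx₀ hx₁ hy₀ hy₁⟩
        intro heq
        rw [heq] at h
        simp at h
    · cases hb : Nat.ble (83 * (y₁ - y₀)) (10 * (x₁ - x₀)) <;>
        rw [hb] at h <;> simp only [cond_true, cond_false, Bool.and_eq_true] at h
      · rcases split y₀ y₁ Y with hs | hs
        · exact step _ _ _ _ _ _ _ _ h.1 hx₀ hx₁ hy₀ hs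
        · exact step _ _ _ _ _ _ _ _ h.2 hx₀ hx₁ hs hy₁
      · rcases split x₀ x₁ X with hs | hs
        · exact step _ _ _ _ _ _ _ _ h.1 hx₀ hs hy₀ hy₁
        · exact step _ _ _ _ _ _ _ _ h.2 hs hx₁ hy₀ hy₁

theorem coverPoints_parity : ∀ q ∈ coverPoints, 2 ∣ q.1 - q.2 ∧ -4096 ≤ q.1 ∧ -4096 ≤ q.2 := by
  decide

/-- A translate of norm at most `κ` has to lie in the exempt class `t`; two incongruent ones cannot
both do so. Only the exceptional boxes survive, with their grid bounds rounded outward to decimals.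
-/
theorem exceptional_of_isExposed {κ x y : ℝ} {t : ℤ} (hκ : 0.9998 ≤ κ) (h : IsExposed κ x y t)
    (hx₀ : 0 ≤ x) (hx₁ : x ≤ 1 / 2) (hy₀ : 0 ≤ y) (hy₁ : y ≤ 1 / 4) :
    (x ≤ 0.008 ∧ y ≤ 0.001) ∨ (x ≤ 0.005 ∧ 0.1731 ≤ y ∧ y ≤ 0.1747) ∨
    (0.005 ≤ x ∧ x ≤ 0.012 ∧ 0.174 ≤ y ∧ y ≤ 0.176) ∨
    (0.205 ≤ x ∧ x ≤ 0.213 ∧ 0.198 ≤ y ∧ y ≤ 0.2002) := by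
  have hgood : ∀ q ∈ coverGrid,
      |(2 ^ 20 * x + 2 ^ 31 - q.1) ^ 2 - 69 * (2 ^ 20 * y + 2 ^ 31 - q.2) ^ 2| ≤ 1099291722219 →
      (23 : ℤ) ∣ (q.1 / 524288 : ℕ) - 4096 - t := by
    intro q hq hle
    obtain ⟨⟨a, b⟩, hab, rfl⟩ := List.mem_map.mp hq
    obtain ⟨hpar, ha, hb⟩ := coverPoints_parity _ hab
    simp only at hpar ha hb hle ⊢
    obtain ⟨m, hm⟩ := Int.eq_ofNat_of_zero_le (by linarith : 0 ≤ a + 4096)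
    obtain ⟨n, hn⟩ := Int.eq_ofNat_of_zero_le (by linarith : 0 ≤ b + 4096)
    rw [hm, hn] at hle
    rw [hm]
    simp only [Int.toNat_natCast, Nat.mul_div_cancel _ (show 0 < 524288 by norm_num)] at hle ⊢
    have hm' : (m : ℝ) = a + 4096 := by exact_mod_cast hm.symm
    have hn' : (n : ℝ) = b + 4096 := by exact_mod_cast hn.symm
    rw [← hm, add_sub_cancel_right]
    by_contra hd
    have := h a b hpar hd
    push_cast at hle
    rw [hm', hn'] at hle
    have e : (2 ^ 20 * x + 2 ^ 31 - (a + 4096) * 524288) ^ 2 -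
        69 * (2 ^ 20 * y + 2 ^ 31 - (b + 4096) * 524288) ^ 2 =
        2 ^ 40 * ((x - a / 2) ^ 2 - 69 * (y - b / 2) ^ 2) := by ring
    rw [e, abs_mul, abs_of_pos (by positivity : (0 : ℝ) < 2 ^ 40)] at hle
    norm_num at hκ hle
    linarith
  rcases boxCovered_sound 30 coverGrid _ _ _ _ (2 ^ 20 * x + 2 ^ 31) (2 ^ 20 * y + 2 ^ 31)
    boxCovered_quarter (by norm_num; linarith) (by norm_num; linarith) (by norm_num; linarith)
    (by norm_num; linarith) with ⟨e, he, h1, h2, h3, h4⟩ | ⟨q, hq, r, hr, hne, h1, h2⟩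
  · simp only [exceptionalBoxes, List.mem_cons, List.not_mem_nil, or_false] at he
    norm_num at h1 h2 h3 h4
    norm_num
    rcases he with rfl | rfl | rfl | rfl <;> norm_num at h1 h2 h3 h4
    · left; constructor <;> linarith
    · right; left; refine ⟨?_, ?_, ?_⟩ <;> linarith
    · right; right; left; refine ⟨?_, ?_, ?_, ?_⟩ <;> linarith
    · right; right; right; refine ⟨?_, ?_, ?_, ?_⟩ <;> linarith
  · exfalso
    have d1 := hgood q hq h1
    have d2 := hgood r hr h2
    omega

theorem sqrt69_sq : √69 * √69 = 69 := Real.mul_self_sqrt (by norm_num)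

theorem sqrt69_gt : 8.30662 < √69 := Real.lt_sqrt_of_sq_lt (by norm_num)

theorem sqrt69_lt : √69 < 8.30663 := (Real.sqrt_lt' (by norm_num)).mpr (by norm_num)

/-- The irrational value `(75√69 - 600) / 23` of the first minimum. -/
def limitMinimum : ℝ := 1 / 23 * (-600 + 75 * √69)

theorem limitMinimum_gt : 0.9998 < limitMinimum := by
  have := sqrt69_gt; unfold limitMinimum; norm_num at *; linarith

theorem limitMinimum_lt : limitMinimum < 1 := by
  have := sqrt69_lt; unfold limitMinimum; norm_num at *; linarith

/-! ### Dynamics of the fundamental unit on exposed points -/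

namespace IsExposed

variable {κ x y : ℝ} {t : ℤ}

/-- The class of `(a + b√69)/2` modulo the prime depends only on `a`, so conjugation preserves it.
-/
theorem conj (h : IsExposed κ x y t) : IsExposed κ x (-y) t := by
  intro a b hab ha
  have := h a (-b) (by omega) ha
  push_cast at this
  convert this using 2
  ring

theorem reflect (h : IsExposed κ x y t) : IsExposed κ (-x) y (-t) := by
  intro a b hab ha
  have := h (-a) b (by omega) (by omega)
  push_cast at this
  convert this using 2
  ring

theorem add (h : IsExposed κ x y t) (m n : ℤ) (hmn : 2 ∣ m - n) :
    IsExposed κ (x + m / 2) (y + n / 2) (t + m) := by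
  intro a b hab ha
  have := h (a - m) (b - n) (by omega) (by omega)
  push_cast at this
  convert this using 2
  ring

/-- The unit `ε = (25 + 3√69)/2` has norm 1 and is congruent to `25/2 ≡ 1` modulo the prime, so the
exempt class does not change. -/
theorem mul_unit (h : IsExposed κ x y t) :
    IsExposed κ ((25 * x + 207 * y) / 2) ((3 * x + 25 * y) / 2) t := by
  intro a b hab ha
  obtain ⟨k, hk⟩ := hab
  obtain rfl : a = b + 2 * k := by linarith
  -- These are the coordinates of `ε⁻¹ q` for `q = (a + b√69)/2`.
  have := h (-91 * b + 25 * k) (11 * b - 3 * k) (by omega) (by omega)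
  push_cast at this ⊢
  convert this using 2
  ring

theorem mul_unit_inv (h : IsExposed κ x y t) :
    IsExposed κ ((25 * x - 207 * y) / 2) ((25 * y - 3 * x) / 2) t := by
  have := h.conj.mul_unit.conj
  convert this using 1 <;> ring

/-- Multiplication by the unit, in coordinates centred at `4√69/23`. -/
theorem center_mul_unit {v : ℝ} (h : IsExposed κ x (4 / 23 + v) t) :
    IsExposed κ ((25 * x + 207 * v) / 2) (4 / 23 + (3 * x + 25 * v) / 2) (t - 36) := by
  have := h.mul_unit.add (-36) (-4) (by norm_num)
  convert this using 1 <;> push_cast <;> ring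

theorem center_mul_unit_inv {v : ℝ} (h : IsExposed κ x (4 / 23 + v) t) :
    IsExposed κ ((25 * x - 207 * v) / 2) (4 / 23 + (25 * v - 3 * x) / 2) (t + 36) := by
  have := h.mul_unit_inv.add 36 (-4) (by norm_num)
  convert this using 1 <;> push_cast <;> ring

theorem exists_abs (h : IsExposed κ x y t) : ∃ t', IsExposed κ |x| |y| t' := by
  rcases abs_choice x with hx | hx <;> rcases abs_choice y with hy | hy <;> rw [hx, hy]
  exacts [⟨_, h⟩, ⟨_, h.conj⟩, ⟨_, h.reflect⟩, ⟨_, h.reflect.conj⟩]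

theorem exceptional (hκ : limitMinimum ≤ κ) (h : IsExposed κ x y t)
    (hx : |x| ≤ 1 / 2) (hy : |y| ≤ 1 / 4) :
    (|x| ≤ 0.008 ∧ |y| ≤ 0.001) ∨ (|x| ≤ 0.005 ∧ 0.1731 ≤ |y| ∧ |y| ≤ 0.1747) ∨
    (0.005 ≤ |x| ∧ |x| ≤ 0.012 ∧ 0.174 ≤ |y| ∧ |y| ≤ 0.176) ∨
    (0.205 ≤ |x| ∧ |x| ≤ 0.213 ∧ 0.198 ≤ |y| ∧ |y| ≤ 0.2002) := by
  obtain ⟨t', h'⟩ := h.exists_abs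
  exact exceptional_of_isExposed (limitMinimum_gt.le.trans hκ) h' (abs_nonneg _) hx (abs_nonneg _) hy

/-- The bound on `v` keeps `y` within `1/4` and away from the box at the origin. Both boxes on the
connecting orbit have `v > 0`; this sign is what makes the backward argument one-sided. -/
theorem center_exceptional {v : ℝ} (hκ : limitMinimum ≤ κ) (h : IsExposed κ x (4 / 23 + v) t)
    (hx : |x| ≤ 1 / 2) (hv : |v| ≤ 0.07) :
    (|x| ≤ 0.005 ∧ |v| ≤ 0.00082) ∨
    (0.005 ≤ |x| ∧ |x| ≤ 0.012 ∧ 0.00008 ≤ v ∧ v ≤ 0.0021) ∨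
    (0.205 ≤ |x| ∧ |x| ≤ 0.213 ∧ 0.024 ≤ v ∧ v ≤ 0.0263) := by
  rw [abs_le] at hv
  norm_num at hv
  have hy : |4 / 23 + v| = 4 / 23 + v := abs_of_nonneg (by linarith)
  have := h.exceptional hκ hx (by rw [hy]; linarith)
  rw [hy] at this
  norm_num at this ⊢
  rcases this with ⟨h1, h2⟩ | ⟨h1, h2, h3⟩ | ⟨h1, h2, h3, h4⟩ | ⟨h1, h2, h3, h4⟩
  · linarith
  · left; refine ⟨h1, abs_le.mpr ⟨?_, ?_⟩⟩ <;> linarith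
  · right; left; refine ⟨h1, h2, ?_, ?_⟩ <;> linarith
  · right; right; refine ⟨h1, h2, ?_, ?_⟩ <;> linarith

/-- Stepping back along the orbit leads into the small neighbourhood of `4√69/23`, if the
contracting coordinate `x - √69 v` is positive and the expanding one is small. -/
theorem center_back {v : ℝ} (hκ : limitMinimum ≤ κ) (h : IsExposed κ x (4 / 23 + v) t)
    (hD : 0 < x - √69 * v) (hE : x + √69 * v ≤ 0.03)
    (hx : |(25 * x - 207 * v) / 2| ≤ 0.2) (hv : |(25 * v - 3 * x) / 2| ≤ 0.07) :
    |(25 * x - 207 * v) / 2| ≤ 0.005 ∧ |(25 * v - 3 * x) / 2| ≤ 0.00082 := by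
  have s1 := sqrt69_gt
  have s2 := sqrt69_lt
  have ss := sqrt69_sq
  rcases h.center_mul_unit_inv.center_exceptional hκ (by norm_num at hx ⊢; linarith) hv with
    h1 | ⟨h1, h2, h3, h4⟩ | ⟨h1, h2, h3, h4⟩
  · exact h1
  · exfalso
    set x' := (25 * x - 207 * v) / 2 with hx'
    set v' := (25 * v - 3 * x) / 2 with hv'
    have e1 : x' - √69 * v' = (25 + 3 * √69) / 2 * (x - √69 * v) := by
      rw [hx', hv']; linear_combination (3 / 2 * v) * ss
    have e2 : x' + √69 * v' = (25 - 3 * √69) / 2 * (x + √69 * v) := by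
      rw [hx', hv']; linear_combination (3 / 2 * v) * ss
    have hv0 : 0 ≤ √69 * v' := mul_nonneg (by linarith) (by norm_num at h3; linarith)
    have hD' : 0 < x' - √69 * v' := by
      rw [e1]; exact mul_pos (by linarith) hD
    rw [abs_of_pos (by linarith)] at h1
    have hη : (25 - 3 * √69) / 2 * (x + √69 * v) ≤ 0.0401 * 0.03 := by
      norm_num at s1 s2 hE ⊢
      nlinarith
    norm_num at h1 hη
    linarith
  · norm_num at hx h1; linarith

/-- `ε⁻¹` multiplies `x - √69 v` by `ε > 24`. If this coordinate were positive, `center_back` would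
keep the whole backward orbit in the small box, where it is bounded. -/
theorem center_near_contracting {v : ℝ} (hκ : limitMinimum ≤ κ)
    (h : IsExposed κ x (4 / 23 + v) t) (hx : |x| ≤ 0.005) (hv : |v| ≤ 0.00082) :
    x - √69 * v ≤ 0 := by
  by_contra! hD
  have s1 := sqrt69_gt
  have s2 := sqrt69_lt
  have ss := sqrt69_sq
  norm_num at s1 s2
  have key : ∀ n : ℕ, ∃ x' v' : ℝ, ∃ t' : ℤ, IsExposed κ x' (4 / 23 + v') t' ∧
      |x'| ≤ 0.005 ∧ |v'| ≤ 0.00082 ∧ (24 : ℝ) ^ n * (x - √69 * v) ≤ x' - √69 * v' := by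
    intro n
    induction n with
    | zero => exact ⟨x, v, t, h, hx, hv, by simp⟩
    | succ n ih =>
      obtain ⟨x', v', t', h', hx', hv', hle⟩ := ih
      have hpos : 0 < x' - √69 * v' := lt_of_lt_of_le (by positivity) hle
      have hb := abs_le.mp hx'
      have hc := abs_le.mp hv'
      norm_num at hb hc
      have := h'.center_back hκ hpos (by norm_num; nlinarith)
        (by norm_num; rw [abs_le]; constructor <;> linarith)
        (by norm_num; rw [abs_le]; constructor <;> linarith)
      refine ⟨_, _, _, h'.center_mul_unit_inv, this.1, this.2, ?_⟩
      have e1 : (25 * x' - 207 * v') / 2 - √69 * ((25 * v' - 3 * x') / 2) =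
          (25 + 3 * √69) / 2 * (x' - √69 * v') := by
        linear_combination (3 / 2 * v') * ss
      rw [e1, pow_succ]
      nlinarith
  obtain ⟨n, hn⟩ := pow_unbounded_of_one_lt (1 / (x - √69 * v)) (by norm_num : (1 : ℝ) < 24)
  obtain ⟨x', v', t', -, hx', hv', hle⟩ := key n
  rw [div_lt_iff₀ hD] at hn
  have hb := abs_le.mp hx'
  have hc := abs_le.mp hv'
  norm_num at hb hc
  nlinarith

/-- One step back along a point with positive contracting coordinate lands in the small box, where
that sign is impossible. -/
theorem first_excursion_contracting {v : ℝ} (hκ : limitMinimum ≤ κ)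
    (h : IsExposed κ x (4 / 23 + v) t) (hx₀ : 0.005 ≤ x) (hx₁ : x ≤ 0.012)
    (hv₀ : 0.00008 ≤ v) (hv₁ : v ≤ 0.0021) : x - √69 * v ≤ 0 := by
  by_contra! hD
  have s1 := sqrt69_gt
  have s2 := sqrt69_lt
  have ss := sqrt69_sq
  norm_num at s1 s2 hx₀ hx₁ hv₀ hv₁
  have := h.center_back hκ hD (by norm_num; nlinarith)
    (by norm_num; rw [abs_le]; constructor <;> linarith)
    (by norm_num; rw [abs_le]; constructor <;> linarith)
  have h2 := h.center_mul_unit_inv.center_near_contracting hκ this.1 this.2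
  have e1 : (25 * x - 207 * v) / 2 - √69 * ((25 * v - 3 * x) / 2) =
      (25 + 3 * √69) / 2 * (x - √69 * v) := by
    linear_combination (3 / 2 * v) * ss
  rw [e1] at h2
  have : 0 < (25 + 3 * √69) / 2 * (x - √69 * v) := mul_pos (by linarith) hD
  linarith

/-- One step back, a positive contracting coordinate leaves only the first excursion box, which the
previous lemma rules out. -/
theorem second_excursion_contracting {v : ℝ} (hκ : limitMinimum ≤ κ)
    (h : IsExposed κ x (4 / 23 + v) t) (hx₀ : 0.205 ≤ x) (hx₁ : x ≤ 0.213)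
    (hv₀ : 0.02408 ≤ v) (hv₁ : v ≤ 0.02629) : x - √69 * v ≤ 0 := by
  by_contra! hD
  have s1 := sqrt69_gt
  have s2 := sqrt69_lt
  have ss := sqrt69_sq
  norm_num at s1 s2 hx₀ hx₁ hv₀ hv₁
  set x' := (25 * x - 207 * v) / 2 with hx'
  set v' := (25 * v - 3 * x) / 2 with hv'
  have hD' : 0 < x' - √69 * v' := by
    have e1 : x' - √69 * v' = (25 + 3 * √69) / 2 * (x - √69 * v) := by
      rw [hx', hv']; linear_combination (3 / 2 * v) * ss
    rw [e1]; exact mul_pos (by linarith) hD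
  have e2 : x' + √69 * v' = (25 - 3 * √69) / 2 * (x + √69 * v) := by
    rw [hx', hv']; linear_combination (3 / 2 * v) * ss
  have hE : 0.0162 ≤ x' + √69 * v' := by
    rw [e2]
    have : 0.405 ≤ x + √69 * v := by norm_num; nlinarith
    norm_num at this ⊢
    nlinarith
  norm_num at hE
  rcases h.center_mul_unit_inv.center_exceptional hκ
    (by norm_num; rw [abs_le]; constructor <;> linarith)
    (by norm_num; rw [abs_le]; constructor <;> linarith) with
    ⟨h1, h2⟩ | ⟨h1, h2, h3, h4⟩ | ⟨h1, h2, h3, h4⟩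
  · rw [← hx', abs_le] at h1
    rw [← hv', abs_le] at h2
    norm_num at h1 h2
    nlinarith
  · rw [← hx'] at h1 h2
    rw [← hv'] at h3 h4
    have hv0 : 0 ≤ √69 * v' := mul_nonneg (by linarith) (by norm_num at h3; linarith)
    rw [abs_of_pos (by linarith)] at h1 h2
    have := h.center_mul_unit_inv.first_excursion_contracting hκ h1 h2 h3 h4
    rw [← hx', ← hv'] at this
    linarith
  · rw [← hx'] at h1
    have : |x'| < 0.205 := by norm_num; rw [abs_lt]; constructor <;> linarith
    linarith

/-- Here `limitMinimum` arises. In the coordinates `w`, `m` centred at the limit point of the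
connecting orbit, the translates by `(5 + √69)/2` and `60 - 7√69` have norms `-(b - w)(a - m)` and
`-(A + w)(B + m)`, with `b a = A B = limitMinimum`. Since `m ≥ 0`, one of them is at most
`limitMinimum` in absolute value, whatever the sign of `w`. -/
theorem not_second_excursion {v : ℝ} (hκ : limitMinimum ≤ κ)
    (h : IsExposed κ x (4 / 23 + v) t) (hx₀ : 0.205 ≤ x) (hx₁ : x ≤ 0.213)
    (hv₀ : 0.02408 ≤ v) (hv₁ : v ≤ 0.02629) : False := by
  have hD := h.second_excursion_contracting hκ hx₀ hx₁ hv₀ hv₁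
  have s1 := sqrt69_gt
  have s2 := sqrt69_lt
  have ss := sqrt69_sq
  norm_num at s1 s2 hx₀ hx₁ hv₀ hv₁
  have hκ' := limitMinimum_gt
  -- The integer 2 gives a norm of absolute value at most `0.9`, so its class must be the exempt
  -- one. Both 5 and 120 are then outside it, being 5 modulo 23.
  have ht : (23 : ℤ) ∣ 4 - t := by
    by_contra hd
    have := h 4 0 (by norm_num) hd
    have h2 : |(x - (4 : ℤ) / 2) ^ 2 - 69 * (4 / 23 + v - (0 : ℤ) / 2) ^ 2| ≤ 0.9 := by
      have g1 := mul_nonneg (sub_nonneg.mpr hx₀) (by linarith : 0 ≤ 3.795 - x)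
      have g2 := mul_nonneg (sub_nonneg.mpr hx₁) (by linarith : 0 ≤ 3.787 - x)
      have g3 := mul_nonneg (sub_nonneg.mpr hv₀) (by linarith : 0 ≤ v)
      have g4 := mul_nonneg (sub_nonneg.mpr hv₁) (by linarith : 0 ≤ v)
      norm_num at g1 g2 g3 g4 ⊢
      rw [abs_le]
      constructor <;> linarith
    norm_num at this h2 hκ'
    linarith
  have f1 := h 5 1 (by norm_num) (by omega)
  have f2 := h 120 (-14) (by norm_num) (by omega)
  set w := x + √69 * v + 5 - 15 / 23 * √69 with hw
  set m := -(x - √69 * v) with hm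
  have hm0 : 0 ≤ m := by linarith
  have sv0 : 8.30662 * 0.02408 ≤ √69 * v :=
    mul_le_mul (by norm_num; linarith) (by norm_num; linarith) (by norm_num) (by linarith)
  have sv1 : √69 * v ≤ 8.30663 * 0.02629 :=
    mul_le_mul (by norm_num; linarith) (by norm_num; linarith) (by linarith) (by norm_num)
  norm_num at sv0 sv1
  have hm1 : m ≤ 0.0135 := by norm_num; linarith
  have hw0 : -0.0125 ≤ w := by norm_num; linarith
  have hw1 : w ≤ 0.0145 := by norm_num; linarith
  set a := 15 / 46 * √69 - 5 / 2 with ha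
  set b := 15 / 2 - 15 / 46 * √69 with hb
  set A := 180 / 23 * √69 - 65 with hA
  set B := 60 + 165 / 23 * √69 with hB
  have e1 : (x - (5 : ℤ) / 2) ^ 2 - 69 * (4 / 23 + v - (1 : ℤ) / 2) ^ 2 =
      -((b - w) * (a - m)) := by
    rw [hw, hm, ha, hb]; push_cast
    linear_combination ((v - 15 / 46) ^ 2) * ss
  have e2 : (x - (120 : ℤ) / 2) ^ 2 - 69 * (4 / 23 + v - (-14 : ℤ) / 2) ^ 2 =
      -((A + w) * (B + m)) := by
    rw [hw, hm, hA, hB]; push_cast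
    linear_combination ((v + 165 / 23) ^ 2) * ss
  have ab : b * a = limitMinimum := by
    rw [ha, hb, limitMinimum]; linear_combination (-225 / 2116) * ss
  have AB : A * B = limitMinimum := by
    rw [hA, hB, limitMinimum]; linear_combination (29700 / 529) * ss
  rw [e1, abs_neg] at f1
  rw [e2, abs_neg] at f2
  have ha0 : 0.2 ≤ a := by norm_num; linarith
  have ha1 : a ≤ 0.21 := by norm_num; linarith
  have hb0 : 4.7 ≤ b := by norm_num; linarith
  have hA0 : 0.008 ≤ A := by norm_num; linarith
  have hA1 : A ≤ 0.009 := by norm_num; linarith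
  have hB0 : 119 ≤ B := by linarith
  have hB1 : B ≤ 120 := by linarith
  norm_num at hm1 hw0 hw1 ha0 ha1 hb0 hA0 hA1
  have P1 : 0 ≤ (b - w) * (a - m) := mul_nonneg (by linarith) (by linarith)
  rw [abs_of_nonneg P1] at f1
  rcases le_total 0 w with hw2 | hw2
  · have : (b - w) * (a - m) ≤ b * a :=
      mul_le_mul (by linarith) (by linarith) (by linarith) (by linarith)
    linarith
  · rcases le_total (-w) m with h3 | h3
    · have h4 : a * -w ≤ a * m := mul_le_mul_of_nonneg_left h3 (by linarith)
      have h5 : a * m ≤ b * m := mul_le_mul_of_nonneg_right (by linarith) hm0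
      have h6 : 0 ≤ -w * m := mul_nonneg (by linarith) hm0
      have : (b - w) * (a - m) = b * a + a * -w - b * m - -w * m := by ring
      linarith
    · have : |(A + w) * (B + m)| ≤ limitMinimum := by
        have h4 : A * m ≤ A * -w := mul_le_mul_of_nonneg_left h3 (by linarith)
        have h5 : A * -w ≤ B * -w := mul_le_mul_of_nonneg_right (by linarith) (by linarith)
        have h6 : 0 ≤ -w * m := mul_nonneg (by linarith) hm0
        have h7 : (A + w) * (B + m) = A * B + A * m - B * -w - -w * m := by ring
        have h8 : 0 ≤ (A + w + 0.005) * (B + m) :=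
          mul_nonneg (by norm_num; linarith) (by linarith)
        norm_num at h8 hκ'
        rw [abs_le]
        constructor <;> linarith
      linarith

/-- One step forward, the first excursion box can only meet the second, which is already empty. -/
theorem not_first_excursion {v : ℝ} (hκ : limitMinimum ≤ κ)
    (h : IsExposed κ x (4 / 23 + v) t) (hx₀ : 0.005 ≤ x) (hx₁ : x ≤ 0.012)
    (hv₀ : 0.00008 ≤ v) (hv₁ : v ≤ 0.0021) : False := by
  norm_num at hx₀ hx₁ hv₀ hv₁
  have hp : |(25 * x + 207 * v) / 2| = (25 * x + 207 * v) / 2 := abs_of_pos (by linarith)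
  have hy : |4 / 23 + (3 * x + 25 * v) / 2| = 4 / 23 + (3 * x + 25 * v) / 2 :=
    abs_of_pos (by linarith)
  rcases h.center_mul_unit.exceptional hκ (by rw [hp]; linarith) (by rw [hy]; linarith) with
    ⟨h1, h2⟩ | ⟨h1, h2, h3⟩ | ⟨h1, h2, h3, h4⟩ | ⟨h1, h2, h3, h4⟩
  · rw [hp] at h1; norm_num at h1; linarith
  · rw [hp] at h1; norm_num at h1; linarith
  · rw [hp] at h2; norm_num at h2; linarith
  · rw [hp] at h1 h2; rw [hy] at h3 h4
    norm_num at h3 h4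
    exact h.center_mul_unit.not_second_excursion hκ h1 h2 (by norm_num; linarith)
      (by norm_num; linarith)

/-- The exceptional boxes on the heteroclinic orbit contain no exposed points. -/
theorem near_fixed_point (hκ : limitMinimum ≤ κ) (h : IsExposed κ x y t)
    (hx : |x| ≤ 1 / 2) (hy : |y| ≤ 1 / 4) :
    (|x| ≤ 0.008 ∧ |y| ≤ 0.001) ∨ (|x| ≤ 0.005 ∧ |(|y| - 4 / 23)| ≤ 0.00082) := by
  obtain ⟨t', h'⟩ := h.exists_abs
  have h'' : IsExposed κ |x| (4 / 23 + (|y| - 4 / 23)) t' := by convert h' using 1; ring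
  rcases h.exceptional hκ hx hy with h1 | ⟨h1, h2, h3⟩ | ⟨h1, h2, h3, h4⟩ | ⟨h1, h2, h3, h4⟩
  · exact Or.inl h1
  · right
    norm_num at h2 h3 ⊢
    refine ⟨by norm_num at h1; exact h1, abs_le.mpr ⟨?_, ?_⟩⟩ <;> linarith
  · exfalso
    norm_num at h3 h4
    exact h''.not_first_excursion hκ h1 h2 (by norm_num; linarith) (by norm_num; linarith)
  · exfalso
    norm_num at h3 h4
    exact h''.not_second_excursion hκ h1 h2 (by norm_num; linarith) (by norm_num; linarith)

/-- With the excursions excluded, the forward orbit cannot leave the small box, while `ε` multiplies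
`x + √69 v` by more than 24 at each step. -/
theorem center_expanding_eq_zero {v : ℝ} (hκ : limitMinimum ≤ κ)
    (h : IsExposed κ x (4 / 23 + v) t) (hx : |x| ≤ 0.005) (hv : |v| ≤ 0.00082) :
    x + √69 * v = 0 := by
  by_contra hD
  have s1 := sqrt69_gt
  have s2 := sqrt69_lt
  have ss := sqrt69_sq
  norm_num at s1 s2
  have key : ∀ n : ℕ, ∃ x' v' : ℝ, ∃ t' : ℤ, IsExposed κ x' (4 / 23 + v') t' ∧
      |x'| ≤ 0.005 ∧ |v'| ≤ 0.00082 ∧ (24 : ℝ) ^ n * |x + √69 * v| ≤ |x' + √69 * v'| := by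
    intro n
    induction n with
    | zero => exact ⟨x, v, t, h, hx, hv, by simp⟩
    | succ n ih =>
      obtain ⟨x', v', t', h', hx', hv', hle⟩ := ih
      have hb := abs_le.mp hx'
      have hc := abs_le.mp hv'
      norm_num at hb hc
      have hy : |4 / 23 + (3 * x' + 25 * v') / 2| = 4 / 23 + (3 * x' + 25 * v') / 2 :=
        abs_of_pos (by linarith)
      have := h'.center_mul_unit.near_fixed_point hκ
        (by rw [abs_le]; constructor <;> linarith) (by rw [hy]; linarith)
      rw [hy, add_sub_cancel_left] at this
      have h2 : |(25 * x' + 207 * v') / 2| ≤ 0.005 ∧ |(3 * x' + 25 * v') / 2| ≤ 0.00082 := by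
        rcases this with ⟨-, h2⟩ | h2
        · norm_num at h2; linarith
        · exact h2
      refine ⟨_, _, _, h'.center_mul_unit, h2.1, h2.2, ?_⟩
      have e1 : (25 * x' + 207 * v') / 2 + √69 * ((3 * x' + 25 * v') / 2) =
          (25 + 3 * √69) / 2 * (x' + √69 * v') := by
        linear_combination (-3 / 2 * v') * ss
      rw [e1, pow_succ, abs_mul, abs_of_pos (by linarith : 0 < (25 + 3 * √69) / 2)]
      nlinarith [abs_nonneg (x' + √69 * v')]
  have hD' := abs_pos.mpr hD
  obtain ⟨n, hn⟩ := pow_unbounded_of_one_lt (1 / |x + √69 * v|) (by norm_num : (1 : ℝ) < 24)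
  obtain ⟨x', v', t', -, hx', hv', hle⟩ := key n
  rw [div_lt_iff₀ hD'] at hn
  have hb := abs_le.mp hx'
  have hc := abs_le.mp hv'
  norm_num at hb hc
  have : |x' + √69 * v'| ≤ 1 := by rw [abs_le]; constructor <;> nlinarith
  linarith

theorem origin_expanding_eq_zero (hκ : limitMinimum ≤ κ)
    (h : IsExposed κ x y t) (hx : |x| ≤ 0.008) (hy : |y| ≤ 0.001) :
    x + √69 * y = 0 := by
  by_contra hD
  have s1 := sqrt69_gt
  have s2 := sqrt69_lt
  have ss := sqrt69_sq
  norm_num at s1 s2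
  have key : ∀ n : ℕ, ∃ x' y' : ℝ, ∃ t' : ℤ, IsExposed κ x' y' t' ∧
      |x'| ≤ 0.008 ∧ |y'| ≤ 0.001 ∧ (24 : ℝ) ^ n * |x + √69 * y| ≤ |x' + √69 * y'| := by
    intro n
    induction n with
    | zero => exact ⟨x, y, t, h, hx, hy, by simp⟩
    | succ n ih =>
      obtain ⟨x', y', t', h', hx', hy', hle⟩ := ih
      have hb := abs_le.mp hx'
      have hc := abs_le.mp hy'
      norm_num at hb hc
      have hy2 : |(3 * x' + 25 * y') / 2| ≤ 0.03 := by
        norm_num; rw [abs_le]; constructor <;> linarith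
      have := h'.mul_unit.near_fixed_point hκ
        (by rw [abs_le]; constructor <;> linarith) (by norm_num at hy2; linarith)
      have h2 : |(25 * x' + 207 * y') / 2| ≤ 0.008 ∧ |(3 * x' + 25 * y') / 2| ≤ 0.001 := by
        rcases this with h2 | ⟨-, h2⟩
        · exact h2
        · rw [abs_le] at h2
          norm_num at h2 hy2
          linarith
      refine ⟨_, _, _, h'.mul_unit, h2.1, h2.2, ?_⟩
      have e1 : (25 * x' + 207 * y') / 2 + √69 * ((3 * x' + 25 * y') / 2) =
          (25 + 3 * √69) / 2 * (x' + √69 * y') := by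
        linear_combination (-3 / 2 * y') * ss
      rw [e1, pow_succ, abs_mul, abs_of_pos (by linarith : 0 < (25 + 3 * √69) / 2)]
      nlinarith [abs_nonneg (x' + √69 * y')]
  have hD' := abs_pos.mpr hD
  obtain ⟨n, hn⟩ := pow_unbounded_of_one_lt (1 / |x + √69 * y|) (by norm_num : (1 : ℝ) < 24)
  obtain ⟨x', y', t', -, hx', hy', hle⟩ := key n
  rw [div_lt_iff₀ hD'] at hn
  have hb := abs_le.mp hx'
  have hc := abs_le.mp hy'
  norm_num at hb hc
  have : |x' + √69 * y'| ≤ 1 := by rw [abs_le]; constructor <;> nlinarith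
  linarith

theorem eq_fixed_point (hκ : limitMinimum ≤ κ) (h : IsExposed κ x y t)
    (hx : |x| ≤ 1 / 2) (hy : |y| ≤ 1 / 4) :
    x = 0 ∧ (y = 0 ∨ y = 4 / 23 ∨ y = -(4 / 23)) := by
  have s1 := sqrt69_gt
  norm_num at s1
  rcases h.near_fixed_point hκ hx hy with ⟨h1, h2⟩ | ⟨h1, h2⟩
  · have e1 := h.origin_expanding_eq_zero hκ h1 h2
    have e2 := h.conj.origin_expanding_eq_zero hκ h1 (by rwa [abs_neg])
    have hy0 : √69 * y = 0 := by linarith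
    exact ⟨by linarith, Or.inl ((mul_eq_zero.mp hy0).resolve_left (by linarith))⟩
  · obtain ⟨t', h'⟩ := h.exists_abs
    have h'' : IsExposed κ |x| (4 / 23 + (|y| - 4 / 23)) t' := by convert h' using 1; ring
    have e1 := h''.center_expanding_eq_zero hκ (by rwa [abs_abs]) h2
    -- `x ↦ -x` fixes the centre and exchanges the expanding and contracting coordinates up to sign;
    -- conjugation would move the centre to its negative.
    have e2 := h''.reflect.center_expanding_eq_zero hκ (by rwa [abs_neg, abs_abs]) h2
    have hy0 : √69 * (|y| - 4 / 23) = 0 := by linarith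
    have hy1 := (mul_eq_zero.mp hy0).resolve_left (by linarith)
    refine ⟨abs_eq_zero.mp (by linarith), Or.inr ?_⟩
    exact (abs_eq (by norm_num)).mp (by linarith)

end IsExposed

theorem exists_near_integer (x y : ℝ) :
    ∃ a b : ℤ, 2 ∣ a - b ∧ |x - a / 2| ≤ 1 / 2 ∧ |y - b / 2| ≤ 1 / 4 := by
  set b := round (2 * y)
  set k := round (x - b / 2)
  refine ⟨b + 2 * k, b, ⟨k, by ring⟩, ?_, ?_⟩
  · have := abs_sub_round (x - b / 2)
    rw [show x - ((b + 2 * k : ℤ) : ℝ) / 2 = x - b / 2 - k by push_cast; ring]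
    exact this
  · have := abs_sub_round (2 * y)
    rw [abs_le] at this ⊢
    constructor <;> linarith [this.1, this.2]

theorem IsExposed.eq_integer_add {κ x y : ℝ} {t : ℤ} (hκ : limitMinimum ≤ κ)
    (h : IsExposed κ x y t) : ∃ a b : ℤ, 2 ∣ a - b ∧ x = a / 2 ∧
      (y = b / 2 ∨ y = b / 2 + 4 / 23 ∨ y = b / 2 - 4 / 23) := by
  obtain ⟨a, b, hab, hx, hy⟩ := exists_near_integer x y
  have h' := h.add (-a) (-b) (by omega)
  have h'' : IsExposed κ (x - a / 2) (y - b / 2) (t + -a) := by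
    have e : ∀ z w : ℝ, z - w / 2 = z + -w / 2 := fun z w => by ring
    rw [e, e]
    exact_mod_cast h'
  obtain ⟨h1, h2⟩ := h''.eq_fixed_point hκ hx hy
  refine ⟨a, b, hab, by linarith, ?_⟩
  rcases h2 with h2 | h2 | h2
  · left; linarith
  · right; left; linarith
  · right; right; linarith

/-! ### 23-adic valuations of norms -/

instance fact_prime_23 : Fact (Nat.Prime 23) := ⟨by norm_num⟩

theorem padicValRat_69 : padicValRat 23 69 = 1 := by
  rw [show (69 : ℚ) = 3 * (23 : ℕ) by norm_num, padicValRat.mul (by norm_num) (by norm_num),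
    padicValRat.self (by norm_num)]
  have : padicValRat 23 ((3 : ℕ) : ℚ) = 0 := by
    rw [padicValRat.of_nat, padicValNat.eq_zero_of_not_dvd (by norm_num)]; rfl
  rw [Nat.cast_ofNat] at this
  rw [this]; rfl

theorem padicValRat_69_mul_sq {y : ℚ} (hy : y ≠ 0) :
    padicValRat 23 (69 * y ^ 2) = 1 + 2 * padicValRat 23 y := by
  rw [padicValRat.mul (by norm_num) (pow_ne_zero _ hy), padicValRat_69, padicValRat.pow]
  rfl

/-- The term `69 y²` has strictly smaller valuation, so it dominates. The case `x = 0` is separate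
because `padicValRat` sends 0 to 0. -/
theorem padicValRat_norm_of_lt {x y : ℚ} (hy : y ≠ 0)
    (h : x = 0 ∨ 1 + 2 * padicValRat 23 y < 2 * padicValRat 23 x) :
    padicValRat 23 (x ^ 2 - 69 * y ^ 2) = 1 + 2 * padicValRat 23 y := by
  by_cases hx : x = 0
  · rw [hx, zero_pow two_ne_zero, zero_sub, padicValRat.neg, padicValRat_69_mul_sq hy]
  have h := h.resolve_left hx
  have e2 : padicValRat 23 (x ^ 2) = 2 * padicValRat 23 x := padicValRat.pow _ 
  have e1 : padicValRat 23 (-(69 * y ^ 2)) = 1 + 2 * padicValRat 23 y := by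
    rw [padicValRat.neg, padicValRat_69_mul_sq hy]
  have hne : -(69 * y ^ 2) + x ^ 2 ≠ 0 := by
    intro h0
    have : x ^ 2 = 69 * y ^ 2 := by linarith
    rw [this, padicValRat_69_mul_sq hy] at e2
    omega
  rw [show x ^ 2 - 69 * y ^ 2 = -(69 * y ^ 2) + x ^ 2 by ring, padicValRat.add_eq_of_lt hne
    (neg_ne_zero.mpr (by positivity)) (pow_ne_zero _ hx) (by rw [e1, e2]; exact h), e1]

/-- `x²` has even and `69 y²` odd valuation, so they cannot cancel and each has positive valuation
or vanishes. -/
theorem padicValRat_pos_of_norm {x y : ℚ} (h : 0 < padicValRat 23 (x ^ 2 - 69 * y ^ 2)) :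
    x = 0 ∨ 0 < padicValRat 23 x := by
  by_cases hx : x = 0
  · exact Or.inl hx
  right
  have e2 : padicValRat 23 (x ^ 2) = 2 * padicValRat 23 x := padicValRat.pow _ 
  by_cases hy : y = 0
  · rw [hy, zero_pow two_ne_zero, mul_zero, sub_zero, e2] at h
    omega
  · by_contra hneg
    by_cases hlt : 1 + 2 * padicValRat 23 y < 2 * padicValRat 23 x
    · rw [padicValRat_norm_of_lt hy (Or.inr hlt)] at h
      omega
    · have e1 : padicValRat 23 (-(69 * y ^ 2)) = 1 + 2 * padicValRat 23 y := by
        rw [padicValRat.neg, padicValRat_69_mul_sq hy]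
      have hne : x ^ 2 + -(69 * y ^ 2) ≠ 0 := by
        intro h0
        rw [show x ^ 2 = 69 * y ^ 2 by linarith, padicValRat_69_mul_sq hy] at e2
        omega
      rw [sub_eq_add_neg, padicValRat.add_eq_of_lt hne (pow_ne_zero _ hx)
        (neg_ne_zero.mpr (by positivity)) (by rw [e1, e2]; omega), e2] at h
      omega

theorem dvd_of_padicValRat_pos {x : ℚ} {a a' : ℤ} (h : x - a / 2 = 0 ∨ 0 < padicValRat 23 (x - a / 2))
    (h' : x - a' / 2 = 0 ∨ 0 < padicValRat 23 (x - a' / 2)) : (23 : ℤ) ∣ a - a' := by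
  by_cases he : a = a'
  · simp [he]
  have key : 0 < padicValRat 23 ((x - a' / 2) - (x - a / 2)) := by
    have hne : (x - a' / 2) - (x - a / 2) ≠ 0 := by
      intro h0
      have : (a : ℚ) = a' := by linarith
      exact he (by exact_mod_cast this)
    rcases h with h | h
    · rcases h' with h' | h'
      · exact absurd (by rw [h, h', sub_zero]) hne
      · rw [h, sub_zero]; exact h'
    · rcases h' with h' | h'
      · rw [h', zero_sub, padicValRat.neg]; exact h
      · rw [sub_eq_add_neg] at hne ⊢
        have := padicValRat.min_le_padicValRat_add (p := 23) hne
        rw [padicValRat.neg] at this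
        exact lt_of_lt_of_le (lt_min h' h) this
  have h2 : padicValRat 23 ((2 : ℕ) : ℚ) = 0 := by
    rw [padicValRat.of_nat, padicValNat.eq_zero_of_not_dvd (by norm_num)]; rfl
  rw [show (x - a' / 2) - (x - a / 2) = ((a - a' : ℤ) : ℚ) / (2 : ℕ) by push_cast; ring,
    padicValRat.div (by exact_mod_cast sub_ne_zero.mpr he) (by norm_num), h2, sub_zero,
    padicValRat.of_int] at key
  by_contra hd
  rw [padicValInt.eq_zero_of_not_dvd hd] at key
  exact absurd key (by norm_num)

/-- At most one residue class modulo the prime above `23` meets that prime after translation. -/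
theorem exists_residue (x y : ℚ) : ∃ t : ℤ, ∀ a b : ℤ, ¬ (23 : ℤ) ∣ a - t →
    padicValRat 23 ((x - a / 2) ^ 2 - 69 * (y - b / 2) ^ 2) ≤ 0 := by
  by_cases h : ∃ a b : ℤ, 0 < padicValRat 23 ((x - a / 2) ^ 2 - 69 * (y - b / 2) ^ 2)
  · obtain ⟨t, b₀, ht⟩ := h
    refine ⟨t, fun a b hd => ?_⟩
    by_contra! hpos
    exact hd (dvd_of_padicValRat_pos (padicValRat_pos_of_norm hpos) (padicValRat_pos_of_norm ht))
  · push Not at h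
    exact ⟨0, fun a b _ => h a b⟩

/-! ### Weights of translates and the upper bound -/

theorem irrational_sqrt69 : Irrational (√69) := by
  have : ¬ IsSquare 69 := by
    rintro ⟨m, hm⟩
    have : m ≤ 8 := by nlinarith
    interval_cases m <;> omega
  exact_mod_cast irrational_sqrt_natCast_iff.mpr this

theorem irrational_limitMinimum : Irrational limitMinimum := by
  have h : Irrational (((75 / 23 : ℚ) : ℝ) * √69 + ((-600 / 23 : ℚ) : ℝ)) :=
    (irrational_sqrt69.ratCast_mul (by norm_num)).add_ratCast _
  convert h using 1
  unfold limitMinimum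
  push_cast
  ring

theorem normWeight_nonneg {c : ℝ} (hc : 0 < c) (n : ℚ) : 0 ≤ normWeight c n :=
  mul_nonneg (abs_nonneg _) (zpow_nonneg (by positivity) _)

theorem normWeight_eq_zero {c : ℝ} (hc : 0 < c) {n : ℚ} : normWeight c n = 0 ↔ n = 0 := by
  unfold normWeight
  rw [mul_eq_zero, abs_eq_zero, Rat.cast_eq_zero]
  exact or_iff_left (zpow_ne_zero _ (by positivity))

theorem normWeight_mul {c : ℝ} (hc : 0 < c) (m n : ℚ) :
    normWeight c (m * n) = normWeight c m * normWeight c n := by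
  by_cases hm : m = 0
  · simp [hm, normWeight]
  by_cases hn : n = 0
  · simp [hn, normWeight]
  unfold normWeight
  rw [padicValRat.mul hm hn, zpow_add₀ (by positivity), Rat.cast_mul, abs_mul]
  ring

theorem normWeight_le_abs {c : ℝ} (hc : 23 ≤ c) {n : ℚ} (hn : padicValRat 23 n ≤ 0) :
    normWeight c n ≤ |(n : ℝ)| := by
  unfold normWeight
  refine mul_le_of_le_one_right (abs_nonneg _) (zpow_le_one_of_nonpos₀ ?_ hn)
  rw [le_div_iff₀ (by norm_num)]
  linarith

theorem abs_le_normWeight {c : ℝ} (hc : 23 ≤ c) {n : ℚ} (hn : 0 ≤ padicValRat 23 n) :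
    |(n : ℝ)| ≤ normWeight c n := by
  unfold normWeight
  refine le_mul_of_one_le_right (abs_nonneg _) (one_le_zpow₀ ?_ hn)
  rw [le_div_iff₀ (by norm_num)]
  linarith

/-- The norm of `x + y√69 - (a + b√69)/2`. -/
def translateNorm (x y : ℚ) (a b : ℤ) : ℚ := (x - a / 2) ^ 2 - 69 * (y - b / 2) ^ 2

/-- A point at which the norm is not smaller than `limitMinimum` on all residue classes. -/
def IsFixedPoint (x y : ℚ) : Prop :=
  ∃ a b : ℤ, 2 ∣ a - b ∧ x = a / 2 ∧ (y = b / 2 ∨ y = b / 2 + 4 / 23 ∨ y = b / 2 - 4 / 23)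

theorem exists_normWeight_lt {c : ℝ} (hc : 23 ≤ c) (x y : ℚ) (h : ¬ IsFixedPoint x y) :
    ∃ a b : ℤ, 2 ∣ a - b ∧ normWeight c (translateNorm x y a b) < limitMinimum := by
  obtain ⟨t, ht⟩ := exists_residue x y
  by_contra! hcon
  apply h
  have hexp : IsExposed limitMinimum x y t := by
    intro a b hab hd
    have h1 := (hcon a b hab).trans (normWeight_le_abs hc (ht a b hd))
    rw [translateNorm] at h1
    push_cast at h1
    -- Exposedness asks for a strict inequality; equality is impossible because the norm is rational
    -- and `limitMinimum` is not.
    refine lt_of_le_of_ne h1 fun heq => ?_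
    apply irrational_limitMinimum
    refine ⟨|translateNorm x y a b|, ?_⟩
    rw [heq, translateNorm]
    push_cast
    rfl
  obtain ⟨a, b, hab, hx, hy⟩ := hexp.eq_integer_add le_rfl
  refine ⟨a, b, hab, ?_, ?_⟩
  · rify; exact hx
  · rify; exact hy

theorem padicValRat_center {b : ℤ} : padicValRat 23 (4 / 23 - b / 2 : ℚ) = -1 := by
  have h0 : (8 - 23 * b : ℤ) ≠ 0 := by omega
  have h46 : padicValRat 23 ((46 : ℕ) : ℚ) = 1 := by
    rw [show ((46 : ℕ) : ℚ) = (2 : ℕ) * (23 : ℕ) by norm_num,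
      padicValRat.mul (by norm_num) (by norm_num), padicValRat.self (by norm_num),
      padicValRat.of_nat, padicValNat.eq_zero_of_not_dvd (by norm_num)]
    rfl
  rw [show (4 / 23 - b / 2 : ℚ) = ((8 - 23 * b : ℤ) : ℚ) / (46 : ℕ) by push_cast; ring,
    padicValRat.div (by exact_mod_cast h0) (by norm_num), h46, padicValRat.of_int,
    padicValInt.eq_zero_of_not_dvd (by omega)]
  rfl

theorem padicValRat_half_int {a : ℤ} (ha : (a : ℚ) / 2 ≠ 0) :
    0 ≤ padicValRat 23 ((a : ℚ) / 2) := by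
  have ha' : (a : ℚ) ≠ 0 := fun h => ha (by rw [h, zero_div])
  rw [show (a : ℚ) / 2 = a / (2 : ℕ) by norm_num, padicValRat.div ha' (by norm_num),
    padicValRat.of_int, padicValRat.of_nat, padicValNat.eq_zero_of_not_dvd (by norm_num)]
  simp

theorem center_ne_zero (b : ℤ) : (4 / 23 - b / 2 : ℚ) ≠ 0 := by
  intro h
  have h2 : ((8 - 23 * b : ℤ) : ℚ) = 0 := by push_cast; linarith
  have : (8 - 23 * b : ℤ) = 0 := by exact_mod_cast h2
  omega

/-- All these norms have the form `(23 j - 2)/23`, and valuation `-1` turns the denominator 23 into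
`c`. Only `j = 0, 1` would give a numerator below 25 in absolute value (2 or 21), and both are
excluded modulo 9. -/
theorem center_le_normWeight {c : ℝ} (hc : 0 < c) (a b : ℤ) (hab : 2 ∣ a - b) :
    25 / c ≤ normWeight c ((a / 2 : ℚ) ^ 2 - 69 * (4 / 23 - b / 2) ^ 2) := by
  have hv : padicValRat 23 ((a / 2 : ℚ) ^ 2 - 69 * (4 / 23 - b / 2) ^ 2) = -1 := by
    rw [padicValRat_norm_of_lt (center_ne_zero b), padicValRat_center]
    · rfl
    · rw [padicValRat_center]
      by_cases ha : (a : ℚ) / 2 = 0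
      · exact Or.inl ha
      · right
        have := padicValRat_half_int ha
        omega
  obtain ⟨k, hk⟩ := hab
  obtain rfl : a = b + 2 * k := by linarith
  set j : ℤ := k ^ 2 + b * k - 17 * b ^ 2 + 12 * b - 2 with hj
  have hN : (((b + 2 * k : ℤ) : ℚ) / 2) ^ 2 - 69 * (4 / 23 - b / 2) ^ 2 =
      ((23 * j - 2 : ℤ) : ℚ) / 23 := by
    rw [hj]; push_cast; ring
  have hmod : ∀ k b : ZMod 9, k ^ 2 + b * k - 17 * b ^ 2 + 12 * b - 2 ≠ 0 ∧
      k ^ 2 + b * k - 17 * b ^ 2 + 12 * b - 2 ≠ 1 := by decide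
  have hj' := hmod k b
  have h0 : j ≠ 0 := fun h => hj'.1 (by exact_mod_cast congrArg (Int.cast : ℤ → ZMod 9) h)
  have h1 : j ≠ 1 := fun h => hj'.2 (by exact_mod_cast congrArg (Int.cast : ℤ → ZMod 9) h)
  have habs : 25 ≤ |23 * j - 2| := by rw [le_abs]; omega
  have habs' : (25 : ℝ) ≤ |((23 * j - 2 : ℤ) : ℝ)| := by exact_mod_cast habs
  unfold normWeight
  rw [hv, hN, zpow_neg_one, Rat.cast_div, abs_div, Rat.cast_intCast, Rat.cast_ofNat,
    abs_of_pos (by norm_num : (0 : ℝ) < 23), inv_div, div_mul_div_cancel₀ (by norm_num)]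
  exact div_le_div_of_nonneg_right habs' hc.le

theorem normWeight_center {c : ℝ} (hc : 0 < c) :
    normWeight c (1 ^ 2 - 69 * (4 / 23) ^ 2) = 25 / c := by
  have hv : padicValRat 23 ((1 : ℚ) ^ 2 - 69 * (4 / 23) ^ 2) = -1 := by
    have h4 : padicValRat 23 (4 / 23) = -1 := by
      have := padicValRat_center (b := 0); simpa using this
    rw [padicValRat_norm_of_lt (by norm_num) (by rw [h4]; norm_num), h4]
    rfl
  unfold normWeight
  rw [hv, zpow_neg_one]
  norm_num [abs_of_pos, abs_of_neg]
  field_simp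

/-- The points congruent to `± 4√69/23` modulo the integers. -/
def IsCenter (x y : ℚ) : Prop :=
  ∃ a b : ℤ, 2 ∣ a - b ∧ x = a / 2 ∧ (y = b / 2 + 4 / 23 ∨ y = b / 2 - 4 / 23)

theorem IsCenter.le_normWeight {x y : ℚ} {c : ℝ} (hc : 0 < c) (h : IsCenter x y) (a b : ℤ)
    (hab : 2 ∣ a - b) : 25 / c ≤ normWeight c (translateNorm x y a b) := by
  obtain ⟨a₀, b₀, hab₀, rfl, rfl | rfl⟩ := h
  · have := center_le_normWeight hc (a - a₀) (b - b₀) (by omega)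
    convert this using 2
    unfold translateNorm
    push_cast
    ring
  · have := center_le_normWeight hc (a - a₀) (b₀ - b) (by omega)
    convert this using 2
    unfold translateNorm
    push_cast
    ring

theorem IsCenter.exists_normWeight_eq {x y : ℚ} {c : ℝ} (hc : 0 < c) (h : IsCenter x y) :
    ∃ a b : ℤ, 2 ∣ a - b ∧ normWeight c (translateNorm x y a b) = 25 / c := by
  obtain ⟨a₀, b₀, hab₀, rfl, rfl | rfl⟩ := h
  all_goals
    refine ⟨a₀ + 2, b₀, by omega, ?_⟩
    rw [← normWeight_center hc]
    congr 1
    unfold translateNorm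
    push_cast
    ring

theorem IsFixedPoint.eq_integer_or_center {x y : ℚ} (h : IsFixedPoint x y) :
    (∃ a b : ℤ, 2 ∣ a - b ∧ x = a / 2 ∧ y = b / 2) ∨ IsCenter x y := by
  obtain ⟨a, b, hab, hx, hy | hy⟩ := h
  · exact Or.inl ⟨a, b, hab, hx, hy⟩
  · exact Or.inr ⟨a, b, hab, hx, hy⟩

theorem isCenter_basic : IsCenter 0 (4 / 23) := ⟨0, 0, by norm_num, by norm_num, by norm_num⟩

/-- Away from the points `± 4√69/23`, the weighted norm attains values below `limitMinimum`. -/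
theorem exists_normWeight_lt_of_not_center {c : ℝ} (hc : 23 ≤ c) (x y : ℚ)
    (h : ¬ IsCenter x y) :
    ∃ a b : ℤ, 2 ∣ a - b ∧ normWeight c (translateNorm x y a b) < limitMinimum := by
  by_cases hf : IsFixedPoint x y
  · obtain ⟨a, b, hab, rfl, rfl⟩ := hf.eq_integer_or_center.resolve_right h
    refine ⟨a, b, hab, ?_⟩
    have : translateNorm (a / 2) (b / 2) a b = 0 := by unfold translateNorm; ring
    rw [this, (normWeight_eq_zero (by linarith)).mpr rfl]
    linarith [limitMinimum_gt]
  · exact exists_normWeight_lt hc x y hf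

theorem exists_normWeight_le_max {c : ℝ} (hc : 23 ≤ c) (x y : ℚ) :
    ∃ a b : ℤ, 2 ∣ a - b ∧ normWeight c (translateNorm x y a b) ≤ max (25 / c) limitMinimum := by
  by_cases h : IsCenter x y
  · obtain ⟨a, b, hab, he⟩ := h.exists_normWeight_eq (c := c) (by linarith)
    exact ⟨a, b, hab, he ▸ le_max_left _ _⟩
  · obtain ⟨a, b, hab, he⟩ := exists_normWeight_lt_of_not_center hc x y h
    exact ⟨a, b, hab, he.le.trans (le_max_right _ _)⟩

theorem not_isCenter {x y : ℚ} (hy : y = 0 ∨ 0 ≤ padicValRat 23 y) : ¬ IsCenter x y := by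
  rintro ⟨a, b, -, -, h | h⟩
  · have h1 := padicValRat_center (b := -b)
    rw [show (4 / 23 - (-b : ℤ) / 2 : ℚ) = y by rw [h]; push_cast; ring] at h1
    have h2 := center_ne_zero (-b)
    rw [show (4 / 23 - (-b : ℤ) / 2 : ℚ) = y by rw [h]; push_cast; ring] at h2
    rcases hy with hy | hy
    · exact h2 hy
    · omega
  · have h1 := padicValRat_center (b := b)
    rw [show (4 / 23 - b / 2 : ℚ) = -y by rw [h]; ring, padicValRat.neg] at h1
    have h2 := center_ne_zero b
    rw [show (4 / 23 - b / 2 : ℚ) = -y by rw [h]; ring, neg_ne_zero] at h2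
    rcases hy with hy | hy
    · exact h2 hy
    · omega

/-! ### The two real embeddings and reduction to bounded windows -/

/-- The fundamental unit `(25 + 3√69) / 2`. -/
def fundUnit : ℝ := (25 + 3 * √69) / 2

theorem fundUnit_gt : 24.95993 < fundUnit := by
  have := sqrt69_gt; unfold fundUnit; norm_num at *; linarith

theorem fundUnit_lt : fundUnit < 25 := by
  have := sqrt69_lt; unfold fundUnit; norm_num at *; linarith

theorem fundUnit_pos : 0 < fundUnit := lt_trans (by norm_num) fundUnit_gt

theorem fundUnit_inv : fundUnit⁻¹ = (25 - 3 * √69) / 2 := by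
  have := sqrt69_sq
  apply inv_eq_of_mul_eq_one_right
  unfold fundUnit
  linear_combination -9 / 4 * this

/-- The pair `(p, q)` consists of the two real embeddings of an integer of `ℚ(√69)`. -/
def IsEmbedded (p q : ℝ) : Prop :=
  ∃ a b : ℤ, 2 ∣ a - b ∧ p = (a + b * √69) / 2 ∧ q = (a - b * √69) / 2

namespace IsEmbedded

variable {p q p' q' : ℝ}

theorem add (h : IsEmbedded p q) (h' : IsEmbedded p' q') : IsEmbedded (p + p') (q + q') := by
  obtain ⟨a, b, hab, rfl, rfl⟩ := h
  obtain ⟨a', b', hab', rfl, rfl⟩ := h'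
  exact ⟨a + a', b + b', by omega, by push_cast; ring, by push_cast; ring⟩

theorem neg (h : IsEmbedded p q) : IsEmbedded (-p) (-q) := by
  obtain ⟨a, b, hab, rfl, rfl⟩ := h
  exact ⟨-a, -b, by omega, by push_cast; ring, by push_cast; ring⟩

theorem sub (h : IsEmbedded p q) (h' : IsEmbedded p' q') : IsEmbedded (p - p') (q - q') := by
  simpa only [sub_eq_add_neg] using h.add h'.neg

theorem swap (h : IsEmbedded p q) : IsEmbedded q p := by
  obtain ⟨a, b, hab, rfl, rfl⟩ := h
  exact ⟨a, -b, by omega, by push_cast; ring, by push_cast; ring⟩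

theorem fundUnit_mul (h : IsEmbedded p q) : IsEmbedded (fundUnit * p) (fundUnit⁻¹ * q) := by
  obtain ⟨a, b, ⟨k, hk⟩, rfl, rfl⟩ := h
  have := sqrt69_sq
  obtain rfl : a = b + 2 * k := by omega
  refine ⟨116 * b + 25 * k, 14 * b + 3 * k, by omega, ?_, ?_⟩
  · unfold fundUnit; push_cast; linear_combination 3 * b / 4 * this
  · rw [fundUnit_inv]; push_cast; linear_combination 3 * b / 4 * this

theorem pow_mul (h : IsEmbedded p q) (n : ℕ) :
    IsEmbedded (fundUnit ^ n * p) ((fundUnit ^ n)⁻¹ * q) := by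
  induction n with
  | zero => simpa using h
  | succ n ih =>
    have := ih.fundUnit_mul
    rwa [← mul_assoc, ← pow_succ', ← mul_assoc, ← mul_inv, ← pow_succ'] at this

end IsEmbedded

theorem isEmbedded_int (n : ℤ) : IsEmbedded n n :=
  ⟨2 * n, 0, by omega, by push_cast; ring, by push_cast; ring⟩

/-- The real embeddings of the point `4√69 / 23` are fixed modulo the integers. -/
theorem isEmbedded_center_pow (n : ℕ) :
    IsEmbedded (fundUnit ^ n * (4 / 23 * √69) - 4 / 23 * √69)
      ((fundUnit ^ n)⁻¹ * (-(4 / 23 * √69)) - -(4 / 23 * √69)) := by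
  induction n with
  | zero => simpa using isEmbedded_int 0
  | succ n ih =>
    have ss := sqrt69_sq
    have h1 : IsEmbedded (18 + 2 * √69) (18 - 2 * √69) :=
      ⟨36, 4, by norm_num, by push_cast; ring, by push_cast; ring⟩
    have := ih.fundUnit_mul.add h1
    convert this using 1
    · rw [pow_succ', mul_sub]
      have : fundUnit * (4 / 23 * √69) = 50 / 23 * √69 + 18 := by
        unfold fundUnit; linear_combination 6 / 23 * ss
      rw [this]; ring
    · rw [pow_succ', mul_sub, mul_inv]
      have : fundUnit⁻¹ * -(4 / 23 * √69) = -(50 / 23 * √69) + 18 := by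
        rw [fundUnit_inv]; linear_combination 6 / 23 * ss
      rw [this]; ring

section Window

variable {C : ℝ → ℝ → Prop} {G : ℝ → Prop} {F : ℝ} {m r : ℕ}

/-- The flip exchanges the two coordinates, turning a negative exponent `k` into `-k - r`. -/
theorem window_of_mem_Icc
    (hs : ∀ p q, C p q → ∃ p' q', C p' q' ∧ |p'| = fundUnit ^ r * |q| ∧
      |q'| = (fundUnit ^ r)⁻¹ * |p|) (hr : r ≤ 1)
    (hw : ∀ p q, C p q → ∀ k : ℕ, k ≤ m → fundUnit ^ k * |p| < 5 → (fundUnit ^ k)⁻¹ * |q| < 5 →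
      G (|p| * |q|))
    {p q : ℝ} (h : C p q) {k : ℤ} (hk : k ≤ m) (hk' : -m - r ≤ k)
    (hp : fundUnit ^ k * |p| < 5) (hq : (fundUnit ^ k)⁻¹ * |q| < 5) : G (|p| * |q|) := by
  have he := fundUnit_pos.ne'
  rcases le_or_gt 0 k with h0 | h0
  · lift k to ℕ using h0
    rw [zpow_natCast] at hp hq
    exact hw p q h k (by exact_mod_cast hk) hp hq
  · obtain ⟨p', q', h', e1, e2⟩ := hs p q h
    obtain ⟨j, hj⟩ : ∃ j : ℕ, (j : ℤ) = -k - r := ⟨(-k - r).toNat, by omega⟩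
    have hkj : k = -((j + r : ℕ) : ℤ) := by push_cast; omega
    rw [hkj, zpow_neg, zpow_natCast, pow_add, mul_inv] at hp
    rw [hkj, zpow_neg, zpow_natCast, inv_inv, pow_add] at hq
    have := hw p' q' h' j (by omega) (by rw [e1, ← mul_assoc]; exact hq)
      (by rw [e2, ← mul_assoc]; exact hp)
    rw [e1, e2] at this
    convert this using 1
    field_simp

theorem window_of_zpow (hF : |F| = fundUnit ^ (2 * m + r))
    (hC : ∀ p q, C p q → C (F * p) (F⁻¹ * q)) (hC' : ∀ p q, C p q → C (F⁻¹ * p) (F * q))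
    (hs : ∀ p q, C p q → ∃ p' q', C p' q' ∧ |p'| = fundUnit ^ r * |q| ∧
      |q'| = (fundUnit ^ r)⁻¹ * |p|) (hr : r ≤ 1) (hm : 1 ≤ m)
    (hw : ∀ p q, C p q → ∀ k : ℕ, k ≤ m → fundUnit ^ k * |p| < 5 → (fundUnit ^ k)⁻¹ * |q| < 5 →
      G (|p| * |q|))
    {p q : ℝ} (h : C p q) {k : ℤ}
    (hp : fundUnit ^ k * |p| < 5) (hq : (fundUnit ^ k)⁻¹ * |q| < 5) : G (|p| * |q|) := by
  have he := fundUnit_pos.ne'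
  have hF0 : F ≠ 0 := by
    rintro rfl
    rw [abs_zero] at hF
    exact pow_ne_zero _ he hF.symm
  have hz : ∀ j : ℤ, ∀ p q, C p q → C (F ^ j * p) ((F ^ j)⁻¹ * q) := by
    intro j
    induction j with
    | zero => intro p q h; simpa using h
    | succ i ih =>
      intro p q h
      have := hC _ _ (ih p q h)
      rwa [← mul_assoc, ← mul_assoc, ← mul_inv, ← zpow_one_add₀ hF0, add_comm] at this
    | pred i ih =>
      intro p q h
      have := hC' _ _ (ih p q h)
      rw [sub_eq_add_neg, zpow_add₀ hF0, zpow_neg_one, mul_inv, inv_inv]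
      convert this using 1 <;> ring
  -- `F` shifts exponents by `2m + r`, so `k` may be reduced to a remainder in `[-m - r, m]`.
  obtain ⟨i, j, hij, hi, hi'⟩ : ∃ i j : ℤ, k = (2 * m + r) * j + i ∧ i ≤ m ∧ -m - r ≤ i := by
    have h1 := Int.mul_ediv_add_emod k (2 * m + r)
    have h2 := Int.emod_nonneg k (b := 2 * m + r) (by omega)
    have h3 := Int.emod_lt_of_pos k (b := 2 * m + r) (by omega)
    by_cases h4 : k % (2 * m + r) ≤ m
    · exact ⟨_, _, h1.symm, h4, by omega⟩
    · exact ⟨k % (2 * m + r) - (2 * m + r), k / (2 * m + r) + 1, by linarith, by omega, by omega⟩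
  have hFj : |F ^ j| = fundUnit ^ (((2 * m + r : ℕ) : ℤ) * j) := by
    rw [abs_zpow, hF, zpow_mul, zpow_natCast]
  have hk : fundUnit ^ k = fundUnit ^ i * |F ^ j| := by
    rw [hFj, hij, ← zpow_add₀ he]; push_cast; ring_nf
  have hF1 : |F ^ j| ≠ 0 := abs_ne_zero.mpr (zpow_ne_zero j hF0)
  have := window_of_mem_Icc hs hr hw (hz j p q h) hi hi'
    (by rw [abs_mul, ← mul_assoc, ← hk]; exact hp)
    (by rw [abs_mul, abs_inv, ← mul_assoc, ← mul_inv, ← hk]; exact hq)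
  rw [abs_mul, abs_mul, abs_inv] at this
  convert this using 1
  field_simp

/-- To control the products `p * q` on a set of pairs that is invariant under the scaling
`(p, q) ↦ (F p, F⁻¹ q)` and under a flip, it is enough to look at bounded scaled pairs. -/
theorem window_of_invariant (hF : |F| = fundUnit ^ (2 * m + r))
    (hC : ∀ p q, C p q → C (F * p) (F⁻¹ * q)) (hC' : ∀ p q, C p q → C (F⁻¹ * p) (F * q))
    (hs : ∀ p q, C p q → ∃ p' q', C p' q' ∧ |p'| = fundUnit ^ r * |q| ∧
      |q'| = (fundUnit ^ r)⁻¹ * |p|) (hr : r ≤ 1) (hm : 1 ≤ m)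
    (hw : ∀ p q, C p q → ∀ k : ℕ, k ≤ m → fundUnit ^ k * |p| < 5 → (fundUnit ^ k)⁻¹ * |q| < 5 →
      G (|p| * |q|))
    {p q : ℝ} (h : C p q) (hp : p ≠ 0) (hpq : |p| * |q| < 1) : G (|p| * |q|) := by
  have he := fundUnit_pos
  have h1 : 1 < fundUnit := lt_trans (by norm_num) fundUnit_gt
  -- This scaling puts `|p|` in `[1/5, ε/5)`. Since `ε < 25` it is below 5, and `|p| |q| < 1` then
  -- puts the scaled `|q|` below 5 as well.
  obtain ⟨k, hk, hk'⟩ := exists_mem_Ico_zpow (x := 5 * |p|) (by positivity) h1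
  have hz : 0 < fundUnit ^ k := zpow_pos he k
  refine window_of_zpow hF hC hC' hs hr hm hw h (k := -k) ?_ ?_
  · rw [zpow_neg, inv_mul_lt_iff₀ hz]
    rw [zpow_add_one₀ he.ne'] at hk'
    nlinarith [fundUnit_lt]
  · rw [zpow_neg, inv_inv]
    nlinarith [abs_nonneg q]

end Window

/-- Bounded points close to the point `4√69 / 23` do not have small norm. -/
theorem one_le_abs_near_center {p q d e : ℝ}
    (h : IsEmbedded (p - (4 / 23 * √69 + d)) (q - (-(4 / 23 * √69) - e)))
    (hd : 0 ≤ d) (hd' : d ≤ 0.045) (he : 0 ≤ e) (he' : e ≤ 0.045) (hp : |p| < 5) (hq : |q| < 5) :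
    1 ≤ |p| * |q| := by
  obtain ⟨a, b, hab, h1, h2⟩ := h
  have s1 := sqrt69_gt
  have s2 := sqrt69_lt
  norm_num at s1 s2 hd' he'
  rw [abs_lt] at hp hq
  rw [← abs_mul]
  have hb : b = 0 ∨ b = -1 := by
    have h3 : b < 1 := by
      by_contra! hb
      have : (1 : ℝ) ≤ b := by exact_mod_cast hb
      nlinarith
    have h4 : -2 < b := by
      by_contra! hb
      have : (b : ℝ) ≤ -2 := by exact_mod_cast hb
      nlinarith
    omega
  obtain ⟨a1, a2⟩ : -16 < a ∧ a < 16 := by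
    constructor
    · have : (-16 : ℝ) < a := by rcases hb with rfl | rfl <;> push_cast at * <;> linarith
      exact_mod_cast this
    · have : (a : ℝ) < 16 := by rcases hb with rfl | rfl <;> push_cast at * <;> linarith
      exact_mod_cast this
  rcases hb with rfl | rfl
  · interval_cases a <;> first | omega | skip
    all_goals push_cast at h1 h2
    all_goals first
      | (exfalso; linarith)
      | (rw [le_abs]; first | (left; nlinarith) | (right; nlinarith))
  · interval_cases a <;> first | omega | skip
    all_goals push_cast at h1 h2
    all_goals first | (exfalso; linarith) | (rw [le_abs]; right; nlinarith)

theorem half_le_abs_of_bounded {p q d : ℝ}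
    (h : IsEmbedded (p - (4 / 23 * √69 + 1 + d)) (q - (-(4 / 23 * √69) - d)))
    (hd : 0 ≤ d) (hd' : d ≤ 0.01) (hp : |p| < 5) (hq : |q| < 5) :
    1 / 2 ≤ |p| * |q| := by
  obtain ⟨a, b, hab, h1, h2⟩ := h
  have s1 := sqrt69_gt
  have s2 := sqrt69_lt
  norm_num at s1 s2 hd'
  rw [abs_lt] at hp hq
  rw [← abs_mul]
  have hb : b = 0 ∨ b = -1 := by
    have h3 : b < 1 := by
      by_contra! hb
      have : (1 : ℝ) ≤ b := by exact_mod_cast hb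
      nlinarith
    have h4 : -2 < b := by
      by_contra! hb
      have : (b : ℝ) ≤ -2 := by exact_mod_cast hb
      nlinarith
    omega
  obtain ⟨a1, a2⟩ : -16 < a ∧ a < 16 := by
    constructor
    · have : (-16 : ℝ) < a := by rcases hb with rfl | rfl <;> push_cast at * <;> linarith
      exact_mod_cast this
    · have : (a : ℝ) < 16 := by rcases hb with rfl | rfl <;> push_cast at * <;> linarith
      exact_mod_cast this
  rcases hb with rfl | rfl
  · interval_cases a <;> first | omega | skip
    all_goals push_cast at h1 h2
    all_goals first
      | (exfalso; linarith)
      | (rw [le_abs]; first | (left; nlinarith) | (right; nlinarith))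
  · interval_cases a <;> first | omega | skip
    all_goals push_cast at h1 h2
    all_goals first | (exfalso; linarith) | (rw [le_abs]; right; nlinarith)

/-- At `d = e = 0` the base point is, up to conjugation, sign and translation, the limit point
treated in `not_second_excursion`. The case `a = 1`, `b = -1` is the tight one: its norm tends to
`limitMinimum` in absolute value as `d` and `e` tend to 0. -/
theorem eq_or_limitMinimum_sub_le {p q d e : ℝ}
    (h : IsEmbedded (p - (2 + 4 / 23 * √69 + d)) (q - (7 - 19 / 23 * √69 + e)))
    (hd : 0 ≤ d) (hd' : d ≤ 0.01) (he : 0 ≤ e) (he' : e ≤ 0.01) (hp : |p| < 5) (hq : |q| < 5) :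
    (p = 2 + 4 / 23 * √69 + d ∧ q = 7 - 19 / 23 * √69 + e) ∨
      limitMinimum - 5 * d ≤ |p| * |q| := by
  obtain ⟨a, b, hab, h1, h2⟩ := h
  have s1 := sqrt69_gt
  have s2 := sqrt69_lt
  have ss := sqrt69_sq
  have hl := limitMinimum_lt
  norm_num at s1 s2 hd' he'
  rw [abs_lt] at hp hq
  rw [← abs_mul]
  have hb : b = 0 ∨ b = -1 := by
    have h3 : b < 1 := by
      by_contra! hb
      have : (1 : ℝ) ≤ b := by exact_mod_cast hb
      nlinarith
    have h4 : -2 < b := by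
      by_contra! hb
      have : (b : ℝ) ≤ -2 := by exact_mod_cast hb
      nlinarith
    omega
  obtain ⟨a1, a2⟩ : -16 < a ∧ a < 16 := by
    constructor
    · have : (-16 : ℝ) < a := by rcases hb with rfl | rfl <;> push_cast at * <;> linarith
      exact_mod_cast this
    · have : (a : ℝ) < 16 := by rcases hb with rfl | rfl <;> push_cast at * <;> linarith
      exact_mod_cast this
  by_cases ha0 : a = 0
  · left
    obtain rfl : b = 0 := by omega
    subst ha0
    push_cast at h1 h2
    constructor <;> linarith
  right
  by_cases ha1 : a = 1
  · subst ha1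
    obtain rfl : b = -1 := by omega
    push_cast at h1 h2
    obtain rfl : p = 5 / 2 - 15 / 46 * √69 + d := by linarith
    obtain rfl : q = 15 / 2 - 15 / 46 * √69 + e := by linarith
    rw [le_abs, limitMinimum]
    right
    have h3 : 0 ≤ (15 / 46 * √69 - 5 / 2 - d) * e := mul_nonneg (by linarith) he
    have h4 : 0 ≤ d * (15 / 46 * √69 - 5 / 2) := mul_nonneg hd (by linarith)
    linear_combination h3 + h4 + 225 / 2116 * ss
  rw [le_abs]
  rcases hb with rfl | rfl
  · interval_cases a <;> first | omega | skip
    all_goals push_cast at h1 h2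
    all_goals first
      | (exfalso; linarith)
      | (left; nlinarith only [h1, h2, s1, s2, hd, hd', he, he', hl])
      | (right; nlinarith only [h1, h2, s1, s2, hd, hd', he, he', hl])
  · interval_cases a <;> first | omega | skip
    all_goals push_cast at h1 h2
    all_goals first
      | (exfalso; linarith)
      | (right; nlinarith only [h1, h2, s1, s2, hd, hd', he, he', hl])

/-! ### Powers of the Pell unit modulo powers of 23 -/

/-- The fundamental unit of `ℤ[√69]`, the cube of the fundamental unit of the maximal order. -/
def pellUnit : ℤ√69 := ⟨7775, 936⟩

theorem pellUnit_pow_norm (n : ℕ) :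
    (pellUnit ^ n).re * (pellUnit ^ n).re - 69 * ((pellUnit ^ n).im * (pellUnit ^ n).im) = 1 := by
  have : (pellUnit ^ n).norm = 1 := by
    have h1 : Zsqrtd.normMonoidHom pellUnit = 1 := by decide
    have h2 : Zsqrtd.normMonoidHom (pellUnit ^ n) = 1 := by rw [map_pow, h1, one_pow]
    exact h2
  rw [Zsqrtd.norm_def] at this
  linarith

theorem pellUnit_pow_pos (n : ℕ) : 0 < (pellUnit ^ n).re ∧ 0 ≤ (pellUnit ^ n).im := by
  induction n with
  | zero => simp
  | succ n ih =>
    rw [pow_succ, Zsqrtd.re_mul, Zsqrtd.im_mul, pellUnit]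
    obtain ⟨h1, h2⟩ := ih
    rw [pellUnit] at h1 h2
    constructor <;> positivity

theorem pellUnit_pow_toReal (n : ℕ) :
    fundUnit ^ (3 * n) = (pellUnit ^ n).re + (pellUnit ^ n).im * √69 ∧
      (fundUnit ^ (3 * n))⁻¹ = (pellUnit ^ n).re - (pellUnit ^ n).im * √69 := by
  have ss := sqrt69_sq
  have h1 : fundUnit ^ (3 * n) = (pellUnit ^ n).re + (pellUnit ^ n).im * √69 := by
    induction n with
    | zero => simp
    | succ n ih =>
      rw [mul_add, pow_add, ih, pow_succ pellUnit, Zsqrtd.re_mul, Zsqrtd.im_mul, pellUnit, fundUnit]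
      push_cast
      generalize ((⟨7775, 936⟩ : ℤ√69) ^ n).re = T
      generalize ((⟨7775, 936⟩ : ℤ√69) ^ n).im = U
      have : ((25 + 3 * √69) / 2) ^ (3 * 1) = 7775 + 936 * √69 := by
        linear_combination (27 / 8 * √69 + 675 / 8) * ss
      rw [this]
      linear_combination 936 * (U : ℝ) * ss
  refine ⟨h1, ?_⟩
  have h2 : ((pellUnit ^ n).re * (pellUnit ^ n).re -
    69 * ((pellUnit ^ n).im * (pellUnit ^ n).im) : ℝ) = 1 := by exact_mod_cast pellUnit_pow_norm n
  rw [h1]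
  apply inv_eq_of_mul_eq_one_right
  linear_combination h2 - ((pellUnit ^ n).im : ℝ) ^ 2 * ss

theorem not_dvd_pellUnit_pow_re (n : ℕ) : ¬ 23 ∣ (pellUnit ^ n).re := by
  intro h
  have h1 := pellUnit_pow_norm n
  have : (23 : ℤ) ∣ 1 := by
    rw [← h1]
    exact dvd_sub (h.mul_right _) ((by norm_num : (23 : ℤ) ∣ 69).mul_right _)
  norm_num at this

/-- The Pell unit has finite order modulo every positive integer. -/
theorem exists_dvd_pellUnit_pow_sub_one {N : ℕ} (hN : 0 < N) :
    ∃ L : ℕ, 0 < L ∧ ((N : ℤ) : ℤ√69) ∣ pellUnit ^ L - 1 := by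
  have : NeZero N := ⟨hN.ne'⟩
  obtain ⟨i, j, hij, h⟩ := Finite.exists_ne_map_eq_of_infinite
    (fun n : ℕ => (((pellUnit ^ n).re : ZMod N), ((pellUnit ^ n).im : ZMod N)))
  wlog hlt : i < j generalizing i j
  · exact this j i hij.symm h.symm (by omega)
  refine ⟨j - i, by omega, ?_⟩
  have hu : IsUnit (pellUnit ^ i) := by
    rw [Zsqrtd.isUnit_iff_norm_isUnit, Zsqrtd.norm_def, mul_assoc, pellUnit_pow_norm]
    exact isUnit_one
  rw [← hu.dvd_mul_left, mul_sub, ← pow_add, mul_one, Nat.add_sub_cancel' hlt.le,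
    Zsqrtd.intCast_dvd]
  simp only [Prod.mk.injEq, ZMod.intCast_eq_intCast_iff_dvd_sub] at h
  simpa using h

/-- Residues of powers of the Pell unit, by binary exponentiation. -/
def pellResidue (N : ℤ) : List Bool → ℕ × ℤ × ℤ
  | [] => (0, 1, 0)
  | d :: l =>
    let (k, a, b) := pellResidue N l
    let a' := (a * a + 69 * b * b) % N
    let b' := (2 * a * b) % N
    if d then (2 * k + 1, (7775 * a' + 69 * 936 * b') % N, (936 * a' + 7775 * b') % N)
    else (2 * k, a', b')

theorem pellResidue_spec (N : ℤ) (l : List Bool) :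
    (pellUnit ^ (pellResidue N l).1).re ≡ (pellResidue N l).2.1 [ZMOD N] ∧
      (pellUnit ^ (pellResidue N l).1).im ≡ (pellResidue N l).2.2 [ZMOD N] := by
  induction l with
  | nil => simp [pellResidue]
  | cons d l ih =>
    rw [pellResidue]
    rcases hP : pellResidue N l with ⟨k, a, b⟩
    rw [hP] at ih
    obtain ⟨h1, h2⟩ := ih
    simp only at h1 h2
    have e1 : (pellUnit ^ (2 * k)).re ≡ (a * a + 69 * b * b) % N [ZMOD N] := by
      rw [two_mul, pow_add, Zsqrtd.re_mul]
      exact (((h1.mul h1).add ((h2.mul_left 69).mul h2))).trans (Int.mod_modEq _ _).symm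
    have e2 : (pellUnit ^ (2 * k)).im ≡ (2 * a * b) % N [ZMOD N] := by
      rw [two_mul, pow_add, Zsqrtd.im_mul, mul_comm (pellUnit ^ k).im, ← two_mul, ← mul_assoc]
      exact (((h1.mul_left 2).mul h2)).trans (Int.mod_modEq _ _).symm
    cases d
    · exact ⟨e1, e2⟩
    · refine ⟨?_, ?_⟩
      · simp only [if_true]
        rw [pow_succ', Zsqrtd.re_mul]
        exact ((e1.mul_left _).add (e2.mul_left _)).trans (Int.mod_modEq _ _).symm
      · simp only [if_true]
        rw [pow_succ', Zsqrtd.im_mul, add_comm]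
        exact ((e1.mul_left _).add (e2.mul_left _)).trans (Int.mod_modEq _ _).symm

/-- `T + 6U` will be the numerator of the approximating points. One exponent is given by its binary
digits, least significant first; periodicity modulo `23 ^ 5` then makes it arbitrarily large. -/
theorem exists_dvd_pellUnit_pow (n : ℕ) :
    ∃ m, n ≤ m ∧ (23 : ℤ) ^ 5 ∣ (pellUnit ^ m).re + 6 * (pellUnit ^ m).im := by
  obtain ⟨m, h⟩ : ∃ m, (23 : ℤ) ^ 5 ∣ (pellUnit ^ m).re + 6 * (pellUnit ^ m).im := by
    obtain ⟨h1, h2⟩ := pellResidue_spec (23 ^ 5) [true, false, false, true, true, false, true, true, false, false, false, true,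
      false, false, true, true, true, true, false, false, false, false, true]
    refine ⟨_, (Int.modEq_zero_iff_dvd.mp ((h1.add (h2.mul_left 6)).trans ?_))⟩
    decide +kernel
  obtain ⟨L, hL, hd⟩ := exists_dvd_pellUnit_pow_sub_one (N := 23 ^ 5) (by norm_num)
  refine ⟨m + L * n, by nlinarith, ?_⟩
  have h3 : (((23 ^ 5 : ℕ) : ℤ) : ℤ√69) ∣ pellUnit ^ (m + L * n) - pellUnit ^ m := by
    have : pellUnit ^ (m + L * n) - pellUnit ^ m = pellUnit ^ m * ((pellUnit ^ L) ^ n - 1) := by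
      rw [pow_add, pow_mul]; ring
    rw [this]
    exact (hd.trans (sub_one_dvd_pow_sub_one _ _)).mul_left _
  rw [Zsqrtd.intCast_dvd, Zsqrtd.re_sub, Zsqrtd.im_sub] at h3
  push_cast at h3
  have h4 := dvd_add (dvd_add h h3.1) (h3.2.mul_left 6)
  rwa [show (pellUnit ^ m).re + 6 * (pellUnit ^ m).im +
    ((pellUnit ^ (m + L * n)).re - (pellUnit ^ m).re) +
    6 * ((pellUnit ^ (m + L * n)).im - (pellUnit ^ m).im) =
    (pellUnit ^ (m + L * n)).re + 6 * (pellUnit ^ (m + L * n)).im by abel_nf; ring_nf] at h4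

/-! ### Periodic points and the lower bounds -/

theorem IsEmbedded.scale {p q F : ℝ} {n : ℕ} (hF : F = fundUnit ^ n ∨ F = -fundUnit ^ n)
    (h : IsEmbedded p q) :
    IsEmbedded (F * p) (F⁻¹ * q) ∧ IsEmbedded (F⁻¹ * p) (F * q) := by
  have h1 := h.pow_mul n
  have h2 := (h.swap.pow_mul n).swap
  rcases hF with rfl | rfl
  · exact ⟨h1, h2⟩
  · rw [inv_neg]
    simp only [neg_mul]
    exact ⟨h1.neg, h2.neg⟩

/-- If `F` fixes a point modulo the integers, multiplication by `F` and by `F⁻¹` preserves its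
coset. -/
theorem IsEmbedded.coset_scale {z w p q F : ℝ} {n : ℕ} (hF : F = fundUnit ^ n ∨ F = -fundUnit ^ n)
    (hz : IsEmbedded (F * z - z) (F⁻¹ * w - w)) (h : IsEmbedded (p - z) (q - w)) :
    IsEmbedded (F * p - z) (F⁻¹ * q - w) ∧ IsEmbedded (F⁻¹ * p - z) (F * q - w) := by
  have hF0 : F ≠ 0 := by
    have := pow_ne_zero n fundUnit_pos.ne'
    rcases hF with rfl | rfl
    · exact this
    · exact neg_ne_zero.mpr this
  constructor
  · convert (h.scale hF).1.add hz using 1 <;> ring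
  · convert (h.scale hF).2.sub (hz.scale hF).2 using 1 <;> field_simp <;> ring

theorem rat_eq_zero_of_add_sqrt69_mul {x y : ℚ} (h : (x : ℝ) + √69 * y = 0) : y = 0 := by
  by_contra hy
  apply irrational_sqrt69
  refine ⟨-x / y, ?_⟩
  have : (y : ℝ) ≠ 0 := by exact_mod_cast hy
  push_cast
  field_simp
  linarith

theorem translateNorm_cast (x y : ℚ) (a b : ℤ) :
    ((translateNorm x y a b : ℚ) : ℝ) =
      ((x + √69 * y) - (a + b * √69) / 2) * ((x - √69 * y) - (a - b * √69) / 2) := by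
  have ss := sqrt69_sq
  unfold translateNorm
  push_cast
  linear_combination ((y : ℝ) - b / 2) ^ 2 * ss

theorem coset_of_translate (z w : ℝ) {a b : ℤ} (hab : 2 ∣ a - b) :
    IsEmbedded (z - (a + b * √69) / 2 - z) (w - (a - b * √69) / 2 - w) :=
  ⟨-a, -b, by omega, by push_cast; ring, by push_cast; ring⟩

theorem pow_three_mul_ge {L : ℕ} (hL : 0 < L) : 13824 < fundUnit ^ (3 * L) := by
  have h := fundUnit_gt
  calc (13824 : ℝ) = 24 ^ 3 := by norm_num
    _ < fundUnit ^ 3 := by gcongr; linarith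
    _ ≤ fundUnit ^ (3 * L) := pow_le_pow_right₀ (by linarith) (by omega)

theorem le_padicValRat_div {n d : ℤ} {j : ℕ} (hn : n ≠ 0) (hd : ¬ (23 : ℤ) ∣ d)
    (h : (23 : ℤ) ^ j ∣ n) : (j : ℤ) ≤ padicValRat 23 ((n : ℚ) / d) := by
  have hd0 : d ≠ 0 := by rintro rfl; exact hd (dvd_zero _)
  rw [padicValRat.div (by exact_mod_cast hn) (by exact_mod_cast hd0), padicValRat.of_int,
    padicValRat.of_int, padicValInt.eq_zero_of_not_dvd (z := d) (by exact_mod_cast hd)]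
  have := (padicValInt_dvd_iff (p := 23) j n).mp (by exact_mod_cast h)
  have := this.resolve_left hn
  push_cast
  omega

theorem padicValRat_div_le {n d : ℤ} {j : ℕ} (hn : ¬ (23 : ℤ) ∣ n) (hd : d ≠ 0)
    (h : (23 : ℤ) ^ j ∣ d) : padicValRat 23 ((n : ℚ) / d) ≤ -j := by
  have hn0 : n ≠ 0 := by rintro rfl; exact hn (dvd_zero _)
  rw [padicValRat.div (by exact_mod_cast hn0) (by exact_mod_cast hd), padicValRat.of_int,
    padicValRat.of_int, padicValInt.eq_zero_of_not_dvd (z := n) (by exact_mod_cast hn)]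
  have := (padicValInt_dvd_iff (p := 23) j d).mp (by exact_mod_cast h)
  have := this.resolve_left hd
  push_cast
  omega

/-- A point that is fixed by a power of the fundamental unit and stays close to the point
`4√69 / 23` along its orbit has no translates of small norm. -/
theorem half_le_abs_of_coset {L : ℕ} {D : ℝ} (hL : 0 < L) (hD : D * ((fundUnit ^ (3 * L)) ^ 2 - 1) = 1) {p q : ℝ}
    (h : IsEmbedded (p - (4 / 23 * √69 + 1 + D)) (q - (-(4 / 23 * √69) - D))) (hp : p ≠ 0) :
    1 / 2 ≤ |p| * |q| := by
  have hw := pow_three_mul_ge hL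
  set w := fundUnit ^ (3 * L) with hwdef
  have hE : w ^ 2 = fundUnit ^ (2 * (3 * L) + 0) := by rw [hwdef, ← pow_mul]; congr 1; ring
  have hE0 : 0 < w ^ 2 := by positivity
  have hE1 : 0 < w ^ 2 - 1 := by nlinarith
  have hD0 : 0 < D := pos_of_mul_pos_left (by rw [hD]; exact one_pos) hE1.le
  have hDw : D * w ≤ 0.001 := by
    norm_num
    nlinarith
  have hD1 : D ≤ 0.001 := by nlinarith
  norm_num at hDw hD1
  have hz : IsEmbedded (w ^ 2 * (4 / 23 * √69 + 1 + D) - (4 / 23 * √69 + 1 + D))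
      ((w ^ 2)⁻¹ * (-(4 / 23 * √69) - D) - (-(4 / 23 * √69) - D)) := by
    have h1 := (isEmbedded_center_pow (2 * (3 * L) + 0)).add
      ((isEmbedded_int 1).pow_mul (2 * (3 * L) + 0))
    rw [← hE] at h1
    push_cast at h1
    convert h1 using 1
    · linear_combination hD
    · field_simp
      linear_combination 23 * hD
  by_contra! hpq
  refine absurd (window_of_invariant (m := 3 * L) (r := 0) (F := w ^ 2) (G := fun t => 1 / 2 ≤ t)
    (C := fun p q => IsEmbedded (p - (4 / 23 * √69 + 1 + D)) (q - (-(4 / 23 * √69) - D)))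
    ?_ ?_ ?_ ?_ (by norm_num) (by omega) ?_ h hp (by linarith)) (not_le.mpr hpq)
  · rw [abs_of_pos hE0, hE]
  · exact fun p q h => (hz.coset_scale (Or.inl hE) h).1
  · exact fun p q h => (hz.coset_scale (Or.inl hE) h).2
  · intro p q h
    refine ⟨-q, -p, ?_, by simp, by simp⟩
    convert h.neg.swap.sub (isEmbedded_int 1) using 1 <;> push_cast <;> ring
  · intro p q h k hk hp hq
    have hk0 : 0 < fundUnit ^ k := pow_pos fundUnit_pos k
    rcases Nat.eq_zero_or_pos k with rfl | hk1
    · rw [pow_zero, one_mul] at hp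
      rw [pow_zero, inv_one, one_mul] at hq
      exact half_le_abs_of_bounded h hD0.le (by norm_num; linarith) hp hq
    have h1 : fundUnit ^ k ≤ w :=
      pow_le_pow_right₀ (le_trans (by norm_num) fundUnit_gt.le) hk
    have h2 : (fundUnit ^ k)⁻¹ ≤ 0.0401 := by
      rw [inv_le_comm₀ hk0 (by norm_num)]
      calc (0.0401 : ℝ)⁻¹ ≤ fundUnit ^ 1 := by rw [pow_one]; exact le_trans (by norm_num) fundUnit_gt.le
        _ ≤ fundUnit ^ k := pow_le_pow_right₀ (le_trans (by norm_num) fundUnit_gt.le) hk1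
    have h3 : 0 < (fundUnit ^ k)⁻¹ := inv_pos.mpr hk0
    norm_num at h2
    -- Multiplication by `ε ^ k` fixes `4√69/23` modulo integers, and the summand 1 becomes an
    -- integer of `K`. Removing it leaves the offset `ε ^ k D` in one embedding and `ε⁻ᵏ (1 + D)` in
    -- the other, both small.
    have := one_le_abs_near_center (p := fundUnit ^ k * p) (q := (fundUnit ^ k)⁻¹ * q)
      (d := fundUnit ^ k * D) (e := (fundUnit ^ k)⁻¹ * (1 + D)) ?_ (by positivity)
      (by norm_num; nlinarith) (by positivity) (by norm_num; nlinarith)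
      (by rwa [abs_mul, abs_of_pos hk0]) (by rwa [abs_mul, abs_of_pos h3])
    · rw [abs_mul, abs_mul, abs_of_pos hk0, abs_of_pos h3] at this
      have e : fundUnit ^ k * |p| * ((fundUnit ^ k)⁻¹ * |q|) = |p| * |q| := by field_simp
      rw [e] at this
      linarith
    · convert ((h.pow_mul k).add (isEmbedded_center_pow k)).add ((isEmbedded_int 1).pow_mul k)
        using 1 <;> push_cast <;> ring

/-- The norms stay at least `1/2` in absolute value, while the factor `23 ^ (j + 1)` of `U` sits in
the denominator of `y` and makes the weight exceed any bound. -/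
theorem exists_large_of_lt {c : ℝ} (hc : 0 < c) (hc' : c < 23) (M : ℝ) :
    ∃ x y : ℚ, ∀ a b : ℤ, 2 ∣ a - b → M ≤ normWeight c (translateNorm x y a b) := by
  obtain ⟨j, hj⟩ := pow_unbounded_of_one_lt (2 * M) ((one_lt_div hc).mpr hc')
  obtain ⟨L, hL, hd⟩ := exists_dvd_pellUnit_pow_sub_one (N := 23 ^ (j + 1)) (by positivity)
  rw [Zsqrtd.intCast_dvd, Zsqrtd.im_sub, Zsqrtd.im_one, sub_zero] at hd
  replace hd := hd.2
  obtain ⟨hw, hw'⟩ := pellUnit_pow_toReal L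
  have hw1 := pow_three_mul_ge hL
  have hre := not_dvd_pellUnit_pow_re L
  have hn := pellUnit_pow_norm L
  set T := (pellUnit ^ L).re
  set U := (pellUnit ^ L).im
  have ss := sqrt69_sq
  have s0 : 0 < √69 := by positivity
  have hn' : (T * T - 69 * (U * U) : ℝ) = 1 := by exact_mod_cast hn
  have hU : U ≠ 0 := by
    intro h
    rw [h, Int.cast_zero, zero_mul, sub_zero] at hw'
    rw [h, Int.cast_zero, zero_mul, add_zero] at hw
    have := inv_lt_one_of_one_lt₀ (lt_trans (by norm_num) hw1)
    rw [hw'] at this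
    linarith
  have hUr : (U : ℝ) ≠ 0 := by exact_mod_cast hU
  have hUq : (U : ℚ) ≠ 0 := by exact_mod_cast hU
  have h23 : (23 : ℤ) ∣ U := (dvd_pow_self (23 : ℤ) (Nat.succ_ne_zero j)).trans (by exact_mod_cast hd)
  set x : ℚ := 1 / 2 with hx
  -- With `D = 1/(w² - 1)` and `w = T + U√69`, this solves `x + √69 y = 4√69/23 + 1 + D` and `x -
  -- √69 y = -4√69/23 - D`: the point is fixed by `w²` modulo the integers.
  set y : ℚ := 4 / 23 + T / (138 * U) with hy
  set D : ℝ := √69 * T / (138 * U) - 1 / 2 with hD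
  have hDE : D * ((fundUnit ^ (3 * L)) ^ 2 - 1) = 1 := by
    have e : D = √69 * (T - U * √69) / (138 * U) := by
      rw [hD]; field_simp; linear_combination 2 * (U : ℝ) * ss
    have hwv : ((T + U * √69) * (T - U * √69) : ℝ) = 1 := by
      linear_combination hn' - (U : ℝ) ^ 2 * ss
    rw [hw, e, div_mul_eq_mul_div, div_eq_one_iff_eq (by positivity)]
    linear_combination √69 * (T + U * √69) * hwv + 2 * U * ss
  refine ⟨x, y, fun a b hab => ?_⟩
  have hval : y - b / 2 = ((T + 24 * U - 69 * b * U : ℤ) : ℚ) / ((138 * U : ℤ) : ℚ) := by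
    rw [hy]; push_cast; field_simp; ring
  have hnum : ¬ (23 : ℤ) ∣ T + 24 * U - 69 * b * U := by
    intro h
    apply hre
    have h1 : (23 : ℤ) ∣ 24 * U - 69 * b * U := dvd_sub (h23.mul_left _) (h23.mul_left _)
    have := dvd_sub h h1
    rwa [show T + 24 * U - 69 * b * U - (24 * U - 69 * b * U) = T by ring] at this
  have hv : padicValRat 23 (y - b / 2) ≤ -((j + 1 : ℕ) : ℤ) := by
    rw [hval]
    exact padicValRat_div_le hnum (mul_ne_zero (by norm_num) hU) (Dvd.dvd.mul_left (by exact_mod_cast hd) _)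
  have hyb : y - b / 2 ≠ 0 := by
    intro h
    rw [h, padicValRat.zero] at hv
    push_cast at hv
    omega
  have hvN : padicValRat 23 (translateNorm x y a b) = 1 + 2 * padicValRat 23 (y - b / 2) := by
    refine padicValRat_norm_of_lt hyb ?_
    by_cases h : x - a / 2 = 0
    · exact Or.inl h
    · have e : x - a / 2 = ((1 - a : ℤ) : ℚ) / 2 := by rw [hx]; push_cast; ring
      rw [e] at h ⊢
      have := padicValRat_half_int h
      right
      push_cast at hv this ⊢
      omega
  have hz : (x : ℝ) + √69 * y = 4 / 23 * √69 + 1 + D := by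
    rw [hx, hy, hD]; push_cast; ring
  have hz' : (x : ℝ) - √69 * y = -(4 / 23 * √69) - D := by
    rw [hx, hy, hD]; push_cast; ring
  have hN : 1 / 2 ≤ |((translateNorm x y a b : ℚ) : ℝ)| := by
    rw [translateNorm_cast, abs_mul, hz, hz']
    refine half_le_abs_of_coset hL hDE (coset_of_translate _ _ hab) fun h0 => hyb ?_
    apply rat_eq_zero_of_add_sqrt69_mul (x := x - a / 2)
    rw [← hz] at h0
    push_cast
    linear_combination h0
  have hpow : (23 / c) ^ j ≤ (c / 23) ^ padicValRat 23 (translateNorm x y a b) := by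
    rw [← zpow_natCast, ← inv_div c 23, inv_zpow', hvN]
    refine zpow_le_zpow_right_of_le_one₀ (by positivity) ?_ (by push_cast at hv; omega)
    rw [div_le_one (by norm_num)]
    exact hc'.le
  unfold normWeight
  nlinarith [abs_nonneg ((translateNorm x y a b : ℚ) : ℝ), pow_pos (div_pos (by norm_num : (0:ℝ) < 23) hc) j]

theorem one_le_abs_of_scaled {k : ℕ} {D p q : ℝ} (hk : 1 ≤ k) (hD0 : 0 ≤ D) (hD1 : D ≤ 1)
    (hDk : D * fundUnit ^ k ≤ 0.001)
    (h : IsEmbedded (p - (2 + 4 / 23 * √69 + (5 + 15 / 23 * √69) * D))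
      (q - (7 - 19 / 23 * √69 + (15 / 23 * √69 - 5) * D)))
    (hp : fundUnit ^ k * |p| < 5) (hq : (fundUnit ^ k)⁻¹ * |q| < 5) : 1 ≤ |p| * |q| := by
  have hk0 : 0 < fundUnit ^ k := pow_pos fundUnit_pos k
  have h3 : 0 < (fundUnit ^ k)⁻¹ := inv_pos.mpr hk0
  have he := fundUnit_gt
  have s1 := sqrt69_gt
  have s2 := sqrt69_lt
  norm_num at s1 s2 he hDk
  have h2 : (fundUnit ^ k)⁻¹ ≤ 0.0401 := by
    rw [inv_le_comm₀ hk0 (by norm_num)]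
    calc (0.0401 : ℝ)⁻¹ ≤ fundUnit ^ 1 := by rw [pow_one]; norm_num; linarith
      _ ≤ fundUnit ^ k := pow_le_pow_right₀ (by linarith) hk
  have h5 : (5 + 15 / 23 * √69) * (D * fundUnit ^ k) ≤ 11 * 0.001 :=
    mul_le_mul (by linarith) (by norm_num; exact hDk) (by positivity) (by norm_num)
  have h6 : 0 ≤ (15 / 23 * √69 - 5) * (1 - D) := mul_nonneg (by linarith) (by linarith)
  have h7 : (15 / 23 * √69 - 5) * (1 - D) ≤ 0.5 * 1 :=
    mul_le_mul (by norm_num; linarith) (by linarith) (by linarith) (by norm_num)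
  have h8 : (fundUnit ^ k)⁻¹ * ((15 / 23 * √69 - 5) * (1 - D)) ≤ 0.0401 * (0.5 * 1) :=
    mul_le_mul h2 h7 h6 (by norm_num)
  have := one_le_abs_near_center (p := fundUnit ^ k * p) (q := (fundUnit ^ k)⁻¹ * q)
    (d := (5 + 15 / 23 * √69) * (D * fundUnit ^ k))
    (e := (fundUnit ^ k)⁻¹ * ((15 / 23 * √69 - 5) * (1 - D))) ?_ (by positivity)
    (h5.trans (by norm_num)) (mul_nonneg h3.le h6) (h8.trans (by norm_num))
    (by rwa [abs_mul, abs_of_pos hk0]) (by rwa [abs_mul, abs_of_pos h3])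
  · rw [abs_mul, abs_mul, abs_of_pos hk0, abs_of_pos h3] at this
    have e : fundUnit ^ k * |p| * ((fundUnit ^ k)⁻¹ * |q|) = |p| * |q| := by field_simp
    rwa [e] at this
  · convert ((h.pow_mul k).add (isEmbedded_center_pow k)).add ((isEmbedded_int 2).pow_mul k)
      using 1 <;> push_cast <;> ring

/-- On a translate that a power of the fundamental unit reflects, the norm is either a fixed
value or close to `limitMinimum`. -/
theorem eq_or_le_abs_of_coset {L : ℕ} {D κ : ℝ} (hL : 0 < L)
    (hD : D * (fundUnit * (fundUnit ^ (3 * L)) ^ 2 + 1) = 1)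
    (hκ : κ ≤ limitMinimum - 60 * D) {z z' : ℝ}
    (hz : z = 2 + 4 / 23 * √69 + (5 + 15 / 23 * √69) * D)
    (hz' : z' = 7 - 19 / 23 * √69 + (15 / 23 * √69 - 5) * D)
    (hzz : z = fundUnit * z') {p q : ℝ} (h : IsEmbedded (p - z) (q - z')) (hp : p ≠ 0) :
    |p| * |q| = |z| * |z'| ∨ κ ≤ |p| * |q| := by
  have hw := pow_three_mul_ge hL
  have he1 := fundUnit_gt
  have he2 := fundUnit_lt
  have s1 := sqrt69_gt
  have s2 := sqrt69_lt
  have hl := limitMinimum_lt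
  norm_num at s1 s2 he1
  set w := fundUnit ^ (3 * L) with hwdef
  set E := fundUnit * w ^ 2 with hEdef
  have hE : E = fundUnit ^ (2 * (3 * L) + 1) := by
    rw [hEdef, hwdef, ← pow_mul, ← pow_succ']; congr 1; ring
  have hE0 : 0 < E := by positivity
  have hwE : 24 * w * 13824 ≤ E := by rw [hEdef]; nlinarith
  have hD0 : 0 < D := pos_of_mul_pos_left (by rw [hD]; exact one_pos) (by linarith : 0 ≤ E + 1)
  have hDw : D * w ≤ 0.001 := by
    norm_num
    nlinarith
  have hD1 : D ≤ 0.00001 := by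
    norm_num
    nlinarith
  norm_num at hDw hD1
  have hα : (5 + 15 / 23 * √69) * D ≤ 11 * D := mul_le_mul_of_nonneg_right (by linarith) hD0.le
  have hβ : (15 / 23 * √69 - 5) * D ≤ 1 * D := mul_le_mul_of_nonneg_right (by linarith) hD0.le
  have hF : -E = fundUnit ^ (2 * (3 * L) + 1) ∨ -E = -fundUnit ^ (2 * (3 * L) + 1) :=
    Or.inr (by rw [hE])
  -- The sign is essential: `-E` fixes the point because the orbit runs from one centre to its
  -- negative.
  have hfix : IsEmbedded (-E * z - z) ((-E)⁻¹ * z' - z') := by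
    have h1 := ((isEmbedded_center_pow (2 * (3 * L) + 1)).add
      ((isEmbedded_int 2).pow_mul (2 * (3 * L) + 1))).neg
    have h2 : IsEmbedded (7 + √69) (7 - √69) :=
      ⟨14, 2, by norm_num, by push_cast; ring, by push_cast; ring⟩
    rw [← hE] at h1
    have h3 := h1.sub h2
    push_cast at h3
    convert h3 using 1
    · rw [hz]
      linear_combination (-(5 + 15 / 23 * √69)) * hD
    · rw [hz']
      field_simp
      linear_combination (-(15 * √69 - 115)) * hD
  by_contra! hcon
  refine absurd (window_of_invariant (m := 3 * L) (r := 1) (F := -E)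
    (G := fun t => t = |z| * |z'| ∨ κ ≤ t) (C := fun p q => IsEmbedded (p - z) (q - z'))
    ?_ ?_ ?_ ?_ le_rfl (by omega) ?_ h hp (by linarith)) (not_or.mpr ⟨hcon.1, not_le.mpr hcon.2⟩)
  · rw [abs_neg, abs_of_pos hE0, hE]
  · exact fun p q h => (hfix.coset_scale hF h).1
  · exact fun p q h => (hfix.coset_scale hF h).2
  · intro p q h
    -- Since `z = ε z'`, swapping the embeddings and multiplying by `ε` maps the coset to itself.
    refine ⟨fundUnit * q, fundUnit⁻¹ * p, ?_, ?_, ?_⟩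
    · convert h.swap.fundUnit_mul using 1
      · rw [hzz]; ring
      · rw [hzz]; field_simp [fundUnit_pos.ne']
    · rw [abs_mul, abs_of_pos fundUnit_pos, pow_one]
    · rw [abs_mul, abs_inv, abs_of_pos fundUnit_pos, pow_one]
  · intro p q h k hk hp hq
    have hk0 : 0 < fundUnit ^ k := pow_pos fundUnit_pos k
    rcases Nat.eq_zero_or_pos k with rfl | hk1
    · rw [pow_zero, one_mul] at hp
      rw [pow_zero, inv_one, one_mul] at hq
      rw [hz, hz'] at h
      rcases eq_or_limitMinimum_sub_le h (mul_nonneg (by linarith) hD0.le)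
        (by norm_num; linarith) (mul_nonneg (by linarith) hD0.le) (by norm_num; linarith) hp hq with
        ⟨h1, h2⟩ | h1
      · left; rw [h1, h2, hz, hz']
      -- The loss is `5 d` with `d ≤ 11 D`, within the allowance `60 D`.
      · right; linarith
    right
    have h1 : fundUnit ^ k ≤ w := pow_le_pow_right₀ (by linarith) hk
    have h2 : D * fundUnit ^ k ≤ D * w := mul_le_mul_of_nonneg_left h1 hD0.le
    rw [hz, hz'] at h
    have := one_le_abs_of_scaled hk1 hD0.le (by linarith) (by norm_num; linarith) h hp hq
    linarith

/-- The one translate value not near or above `limitMinimum` is `12 y²`, about `0.475`. Its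
valuation is at least 10 and `c/23 ≥ 1.0871`, so its weight is at least `0.475 · 2.3 > 1`. The
denominators are prime to 23, so on the other translates the weight is at least the absolute norm.
-/
theorem exists_near_limitMinimum {c κ : ℝ} (hc : 23 / 15 * (8 + √69) ≤ c)
    (hκ : κ < limitMinimum) : ∃ x y : ℚ, (y = 0 ∨ 0 ≤ padicValRat 23 y) ∧
      ∀ a b : ℤ, 2 ∣ a - b → κ ≤ normWeight c (translateNorm x y a b) := by
  have ss := sqrt69_sq
  have s1 := sqrt69_gt
  have s2 := sqrt69_lt
  have hl := limitMinimum_lt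
  norm_num at s1 s2
  obtain ⟨n, hn⟩ := pow_unbounded_of_one_lt (60 / (limitMinimum - κ))
    (lt_trans (by norm_num) fundUnit_gt)
  obtain ⟨L, hL, hd⟩ := exists_dvd_pellUnit_pow (n + 1)
  have hL0 : 0 < L := by omega
  obtain ⟨hw, hw'⟩ := pellUnit_pow_toReal L
  have hw1 := pow_three_mul_ge hL0
  have hwn : fundUnit ^ n ≤ fundUnit ^ (3 * L) :=
    pow_le_pow_right₀ (le_trans (by norm_num) fundUnit_gt.le) (by omega)
  have hre := not_dvd_pellUnit_pow_re L
  have hnorm := pellUnit_pow_norm L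
  obtain ⟨hT, hU⟩ := pellUnit_pow_pos L
  set T := (pellUnit ^ L).re
  set U := (pellUnit ^ L).im
  have hnorm' : (T * T - 69 * (U * U) : ℝ) = 1 := by exact_mod_cast hnorm
  have hwv : ((T + U * √69) * (T - U * √69) : ℝ) = 1 := by
    linear_combination hnorm' - (U : ℝ) ^ 2 * ss
  have hY : 0 < 3 * T + 23 * U := by omega
  have hX : 0 < T + 6 * U := by omega
  have hYr : (0 : ℝ) < 3 * T + 23 * U := by exact_mod_cast hY
  have hYq : (0 : ℚ) < 3 * T + 23 * U := by exact_mod_cast hY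
  have hYd : ¬ (23 : ℤ) ∣ 3 * (3 * T + 23 * U) := by omega
  set y : ℚ := 2 * (T + 6 * U) / (3 * (3 * T + 23 * U)) with hy
  -- `(9 + √69)/(9 - √69) = ε`, so this encodes the symmetry `z = ε z'`.
  set x : ℚ := 9 * y with hx
  set D : ℝ := (T - U * √69) * (9 - √69) / (6 * (3 * T + 23 * U)) with hDdef
  have hD : D * (fundUnit * (fundUnit ^ (3 * L)) ^ 2 + 1) = 1 := by
    rw [hw, hDdef, fundUnit, div_mul_eq_mul_div, div_eq_one_iff_eq (by positivity)]
    linear_combination (9 - √69) * ((25 + 3 * √69) / 2) * (T + U * √69) * hwv -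
      (T * (3 / 2) + U * (3 / 2 * √69 + 23 / 2) - U * 2 - 23 / 2 * U) * ss
  have hz : (x : ℝ) + √69 * y = 2 + 4 / 23 * √69 + (5 + 15 / 23 * √69) * D := by
    rw [hx, hy, hDdef]; push_cast; field_simp
    linear_combination (45 * T + 60 * U - 45 * U * √69 : ℝ) * ss
  have hz' : (x : ℝ) - √69 * y = 7 - 19 / 23 * √69 + (15 / 23 * √69 - 5) * D := by
    rw [hx, hy, hDdef]; push_cast; field_simp
    linear_combination (45 * T + 750 * U - 45 * U * √69 : ℝ) * ss
  have hzz : (x : ℝ) + √69 * y = fundUnit * (x - √69 * y) := by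
    rw [hx, fundUnit]; push_cast; linear_combination (3 / 2 * y : ℝ) * ss
  have hD0 : 0 < D := by
    have := fundUnit_pos
    exact pos_of_mul_pos_left (by rw [hD]; exact one_pos) (by positivity :
      0 ≤ fundUnit * (fundUnit ^ (3 * L)) ^ 2 + 1)
  have hκD : κ ≤ limitMinimum - 60 * D := by
    have h1 : 60 < (limitMinimum - κ) * fundUnit ^ (3 * L) := by
      rw [div_lt_iff₀ (by linarith)] at hn
      nlinarith
    have h2 : D * fundUnit ^ (3 * L) ≤ 1 := by
      rw [← hD]
      have := fundUnit_gt
      norm_num at this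
      refine mul_le_mul_of_nonneg_left ?_ hD0.le
      nlinarith
    have h3 : 60 * D * fundUnit ^ (3 * L) ≤ (limitMinimum - κ) * fundUnit ^ (3 * L) := by linarith
    have := le_of_mul_le_mul_right h3 (by linarith)
    linarith
  have hc23 : 1.0871 ≤ c / 23 := by
    rw [le_div_iff₀ (by norm_num)]
    norm_num
    linarith
  have hc0 : 23 ≤ c := by
    rw [le_div_iff₀ (by norm_num)] at hc23
    norm_num at hc23
    linarith
  have hvy : (5 : ℤ) ≤ padicValRat 23 y := by
    have : y = ((2 * (T + 6 * U) : ℤ) : ℚ) / ((3 * (3 * T + 23 * U) : ℤ) : ℚ) := by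
      rw [hy]; push_cast; rfl
    rw [this]
    exact le_padicValRat_div (j := 5) (by omega) hYd (hd.mul_left _)
  have hy0 : y ≠ 0 := by
    intro h
    rw [h, padicValRat.zero] at hvy
    omega
  refine ⟨x, y, Or.inr (by omega), fun a b hab => ?_⟩
  have hvN : 0 ≤ padicValRat 23 (translateNorm x y a b) := by
    have e : translateNorm x y a b =
        ((((36 * (T + 6 * U) - 3 * a * (3 * T + 23 * U)) ^ 2 -
          69 * (4 * (T + 6 * U) - 3 * b * (3 * T + 23 * U)) ^ 2 : ℤ)) : ℚ) /
          (((6 * (3 * T + 23 * U)) ^ 2 : ℤ) : ℚ) := by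
      unfold translateNorm
      rw [hx, hy]; push_cast; field_simp; ring
    by_cases h0 : translateNorm x y a b = 0
    · rw [h0, padicValRat.zero]
    rw [e]
    refine le_padicValRat_div (j := 0) ?_ ?_ (by rw [pow_zero]; exact one_dvd _)
    · intro h
      rw [h, Int.cast_zero, zero_div] at e
      exact h0 e
    · intro h
      have := Int.Prime.dvd_pow' (p := 23) (by norm_num) h
      push_cast at this
      omega
  have hle := abs_le_normWeight hc0 hvN
  have hne : ((x : ℝ) + √69 * y) - (a + b * √69) / 2 ≠ 0 := by
    intro h0
    have h1 : y - b / 2 = 0 := by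
      apply rat_eq_zero_of_add_sqrt69_mul (x := x - a / 2)
      push_cast
      linear_combination h0
    rw [hy] at h1
    field_simp at h1
    have h2 : 4 * (T + 6 * U) = 3 * b * (3 * T + 23 * U) := by
      have : (4 * (T + 6 * U) : ℚ) = 3 * b * (3 * T + 23 * U) := by linarith
      exact_mod_cast this
    have h3 : 0 < b := by
      by_contra! hb
      nlinarith
    nlinarith
  rcases eq_or_le_abs_of_coset hL0 hD hκD hz hz' hzz (coset_of_translate _ _ hab) hne with h | h
  · rw [← abs_mul, ← translateNorm_cast, ← abs_mul] at h
    have e : ((x : ℝ) + √69 * y) * (x - √69 * y) = ((12 * y ^ 2 : ℚ) : ℝ) := by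
      rw [hx]; push_cast; linear_combination -(y : ℝ) ^ 2 * ss
    have hlow : 0.475 ≤ |((12 * y ^ 2 : ℚ) : ℝ)| := by
      rw [← e, hz, hz', le_abs]
      left
      have h1 : 3.4446 ≤ 2 + 4 / 23 * √69 + (5 + 15 / 23 * √69) * D := by
        have : 0 ≤ (5 + 15 / 23 * √69) * D := by positivity
        norm_num; linarith
      have h2 : 0.13799 ≤ 7 - 19 / 23 * √69 + (15 / 23 * √69 - 5) * D := by
        have : 0 ≤ (15 / 23 * √69 - 5) * D := mul_nonneg (by linarith) hD0.le
        norm_num; linarith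
      calc (0.475 : ℝ) ≤ 3.4446 * 0.13799 := by norm_num
        _ ≤ _ := mul_le_mul h1 h2 (by norm_num) (by linarith)
    have hv12 : (10 : ℤ) ≤ padicValRat 23 (12 * y ^ 2) := by
      rw [padicValRat.mul (by norm_num) (pow_ne_zero _ hy0), padicValRat.pow]
      have : (0 : ℤ) ≤ padicValRat 23 ((12 : ℤ) : ℚ) := by
        rw [padicValRat.of_int]; positivity
      push_cast at this ⊢
      linarith
    have hv : padicValRat 23 (translateNorm x y a b) = padicValRat 23 (12 * y ^ 2) := by
      rw [e, abs_eq_abs] at h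
      rcases h with h | h
      · rw [show translateNorm x y a b = 12 * y ^ 2 by exact_mod_cast h]
      · rw [show translateNorm x y a b = -(12 * y ^ 2) by exact_mod_cast h, padicValRat.neg]
    have hpow : 2.3 ≤ (c / 23) ^ padicValRat 23 (12 * y ^ 2) := by
      calc (2.3 : ℝ) ≤ 1.0871 ^ 10 := by norm_num
        _ ≤ (c / 23) ^ 10 := by gcongr
        _ = (c / 23) ^ (10 : ℤ) := by norm_cast
        _ ≤ _ := zpow_le_zpow_right₀ (by linarith) hv12
    unfold normWeight
    rw [hv, h, e]
    calc κ ≤ 0.475 * 2.3 := by norm_num; linarith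
      _ ≤ _ := mul_le_mul hlow hpow (by norm_num) (abs_nonneg _)
  · rw [← abs_mul, ← translateNorm_cast] at h
    exact h.trans hle

/-! ### Minima of the weighted norm on K -/

section Field

variable {K : Type*} [Field K] [NumberField K]

theorem pointMinimum_le {f : K → ℝ} {ξ : K} {v : ℝ} (q : 𝓞 K) (h : f (ξ - q) ≤ v) :
    pointMinimum f ξ ≤ (v : EReal) := by
  refine EReal.le_of_forall_lt_iff_le.mp fun κ hκ => ?_
  exact sInf_le ⟨κ, ⟨q, lt_of_le_of_lt h (by exact_mod_cast hκ)⟩, rfl⟩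

theorem le_pointMinimum {f : K → ℝ} {ξ : K} {v : ℝ} (h : ∀ q : 𝓞 K, v ≤ f (ξ - q)) :
    (v : EReal) ≤ pointMinimum f ξ := by
  refine le_sInf ?_
  rintro _ ⟨κ, ⟨q, hq⟩, rfl⟩
  exact EReal.coe_le_coe_iff.mpr ((h q).trans hq.le)

variable (s : 𝓞 K) (hs : s ^ 2 = 69) (hK : IntermediateField.adjoin ℚ {(s : K)} = ⊤)
  (p : HeightOneSpectrum (𝓞 K)) (hp : p.asIdeal = Ideal.span {23, s})

include hs hK hp

theorem weightedNorm_eq_norm {c : ℝ} (hc : 0 < c) (α : K) :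
    weightedNorm p c α = normWeight c (Algebra.norm ℚ α) := by
  obtain ⟨x, y, rfl⟩ := exists_rat_coords s hs hK α
  rw [weightedNorm_eq s hs hK p hp c hc, norm_coords s hs hK]

theorem weightedNorm_mul {c : ℝ} (hc : 0 < c) (α β : K) :
    weightedNorm p c (α * β) = weightedNorm p c α * weightedNorm p c β := by
  simp only [weightedNorm_eq_norm s hs hK p hp hc, map_mul, normWeight_mul hc]

theorem weightedNorm_pos {c : ℝ} (hc : 0 < c) {α : K} (hα : α ≠ 0) : 0 < weightedNorm p c α := by
  rw [weightedNorm_eq_norm s hs hK p hp hc]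
  refine lt_of_le_of_ne (normWeight_nonneg hc _) (Ne.symm ?_)
  rw [Ne, normWeight_eq_zero hc, Algebra.norm_eq_zero_iff]
  exact hα

theorem weightedNorm_translate {c : ℝ} (hc : 0 < c) (x y : ℚ) (a b : ℤ) (q : 𝓞 K)
    (hq : (q : K) = ((a / 2 : ℚ) : K) + ((b / 2 : ℚ) : K) * (s : K)) :
    weightedNorm p c ((x : K) + y * (s : K) - q) = normWeight c (translateNorm x y a b) := by
  have : (x : K) + y * (s : K) - q =
      ((x - a / 2 : ℚ) : K) + ((y - b / 2 : ℚ) : K) * (s : K) := by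
    rw [hq]; push_cast; ring
  rw [this, weightedNorm_eq s hs hK p hp c hc, translateNorm]

theorem exists_translate {c : ℝ} (hc : 0 < c) (x y : ℚ) (a b : ℤ) (hab : 2 ∣ a - b) :
    ∃ q : 𝓞 K, weightedNorm p c ((x : K) + y * (s : K) - q) =
      normWeight c (translateNorm x y a b) := by
  obtain ⟨q, hq⟩ := exists_integer_of_coords s hs a b hab
  exact ⟨q, weightedNorm_translate s hs hK p hp hc x y a b q hq⟩

theorem le_pointMinimum_of_translates {c : ℝ} (hc : 0 < c) {x y : ℚ} {v : ℝ}
    (h : ∀ a b : ℤ, 2 ∣ a - b → v ≤ normWeight c (translateNorm x y a b)) :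
    (v : EReal) ≤ pointMinimum (weightedNorm p c) ((x : K) + y * (s : K)) := by
  refine le_pointMinimum fun q => ?_
  obtain ⟨a, b, hab, hq⟩ := exists_int_coords s hs hK q
  rw [weightedNorm_translate s hs hK p hp hc x y a b q hq]
  exact h a b hab

/-- Multiplicativity lets one divide by `b`, so the division property becomes a statement on the
points `a / b` of `K`. -/
theorem divisionBound_iff {c : ℝ} (hc : 0 < c) (κ : ℝ) :
    DivisionBound (fun a : 𝓞 K => weightedNorm p c (a : K)) κ ↔
      ∀ ξ : K, ∃ q : 𝓞 K, weightedNorm p c (ξ - q) < κ := by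
  constructor
  · intro h ξ
    obtain ⟨a, b, hb, rfl⟩ := IsFractionRing.div_surjective (𝓞 K) ξ
    have hb0 : b ≠ 0 := nonZeroDivisors.ne_zero hb
    have hb0' : (b : K) ≠ 0 := by simpa using hb0
    obtain ⟨q, hq⟩ := h a b hb0
    refine ⟨q, ?_⟩
    have e : ((a - b * q : 𝓞 K) : K) = (b : K) * ((a : K) / b - q) := by
      push_cast; field_simp
    simp only [e, weightedNorm_mul s hs hK p hp hc] at hq
    rw [mul_comm κ] at hq
    exact lt_of_mul_lt_mul_left hq (weightedNorm_pos s hs hK p hp hc hb0').le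
  · intro h a b hb0
    have hb0' : (b : K) ≠ 0 := by simpa using hb0
    obtain ⟨q, hq⟩ := h ((a : K) / b)
    refine ⟨q, ?_⟩
    have e : ((a - b * q : 𝓞 K) : K) = (b : K) * ((a : K) / b - q) := by
      push_cast; field_simp
    simp only [e, weightedNorm_mul s hs hK p hp hc]
    rw [mul_comm κ]
    exact mul_lt_mul_of_pos_left hq (weightedNorm_pos s hs hK p hp hc hb0')

theorem firstMinimum_le {c v : ℝ} (hc : 0 < c)
    (h : ∀ x y : ℚ, ∃ a b : ℤ, 2 ∣ a - b ∧ normWeight c (translateNorm x y a b) ≤ v) :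
    firstMinimum (weightedNorm (K := K) p c) ≤ (v : EReal) := by
  refine EReal.le_of_forall_lt_iff_le.mp fun κ hκ => ?_
  refine sInf_le ⟨κ, ?_, rfl⟩
  refine (divisionBound_iff s hs hK p hp hc κ).mpr fun ξ => ?_
  obtain ⟨x, y, rfl⟩ := exists_rat_coords s hs hK ξ
  obtain ⟨a, b, hab, hle⟩ := h x y
  obtain ⟨q, hq⟩ := exists_translate s hs hK p hp hc x y a b hab
  exact ⟨q, by rw [hq]; exact lt_of_le_of_lt hle (by exact_mod_cast hκ)⟩

theorem pointMinimum_le_firstMinimum {c : ℝ} (hc : 0 < c) (ξ : K) :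
    pointMinimum (weightedNorm p c) ξ ≤ firstMinimum (weightedNorm (K := K) p c) := by
  refine le_sInf ?_
  rintro _ ⟨κ, hκ, rfl⟩
  obtain ⟨q, hq⟩ := (divisionBound_iff s hs hK p hp hc κ).mp hκ ξ
  exact sInf_le ⟨κ, ⟨q, hq⟩, rfl⟩

theorem le_firstMinimum {c v : ℝ} (hc : 0 < c) {x y : ℚ}
    (h : ∀ a b : ℤ, 2 ∣ a - b → v ≤ normWeight c (translateNorm x y a b)) :
    (v : EReal) ≤ firstMinimum (weightedNorm (K := K) p c) :=
  (le_pointMinimum_of_translates s hs hK p hp hc h).trans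
    (pointMinimum_le_firstMinimum s hs hK p hp hc _)

theorem pointMinimum_translate_le {c v : ℝ} (hc : 0 < c) {x y : ℚ}
    (h : ∃ a b : ℤ, 2 ∣ a - b ∧ normWeight c (translateNorm x y a b) ≤ v) :
    pointMinimum (weightedNorm p c) ((x : K) + y * (s : K)) ≤ (v : EReal) := by
  obtain ⟨a, b, hab, hle⟩ := h
  obtain ⟨q, hq⟩ := exists_translate s hs hK p hp hc x y a b hab
  exact pointMinimum_le q (hq ▸ hle)

/-- Norms of integers are integers, and for `c ≥ 23` the weight is at least the absolute norm; so
only finitely many norms contribute. -/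
theorem finite_values {c : ℝ} (hc : 23 ≤ c) (t : ℝ) :
    (Set.range (fun a : 𝓞 K => weightedNorm p c (a : K)) ∩ Set.Icc 0 t).Finite := by
  refine ((Set.finite_Icc (-⌈t⌉) ⌈t⌉).image fun k : ℤ => normWeight c k).subset ?_
  rintro _ ⟨⟨a, rfl⟩, -, ht⟩
  simp only [weightedNorm_eq_norm s hs hK p hp (by linarith : 0 < c), ← Algebra.coe_norm_int]
    at ht ⊢
  set k := Algebra.norm ℤ a
  refine ⟨k, ?_, rfl⟩
  have hk : |(k : ℝ)| ≤ t := by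
    refine le_trans ?_ ht
    have := abs_le_normWeight hc (n := (k : ℚ)) (by rw [padicValRat.of_int]; positivity)
    simpa using this
  rw [abs_le] at hk
  have h1 : t ≤ ⌈t⌉ := Int.le_ceil t
  constructor
  · have : ((-⌈t⌉ : ℤ) : ℝ) ≤ k := by push_cast; linarith
    exact_mod_cast this
  · have : (k : ℝ) ≤ ⌈t⌉ := by linarith
    exact_mod_cast this

theorem euclideanWindow_eq : euclideanWindow p = Set.Ioi 25 := by
  ext c
  constructor
  · rintro ⟨hc, h⟩
    by_contra hle
    have hle : c ≤ 25 := not_lt.mp hle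
    obtain ⟨q, hq⟩ := (divisionBound_iff s hs hK p hp hc 1).mp h.division
      (((0 : ℚ) : K) + ((4 / 23 : ℚ) : K) * (s : K))
    obtain ⟨a, b, hab, hqe⟩ := exists_int_coords s hs hK q
    rw [weightedNorm_translate s hs hK p hp hc _ _ a b q hqe] at hq
    have h1 := isCenter_basic.le_normWeight hc a b hab
    have h2 : 1 ≤ 25 / c := (one_le_div hc).mpr hle
    linarith
  · intro hlt
    have hlt : 25 < c := hlt
    have hc : 0 < c := by linarith
    refine ⟨hc, fun r => ?_, fun t _ => finite_values s hs hK p hp (by linarith) t, fun r => ?_, ?_⟩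
    · simp only [weightedNorm_eq_norm s hs hK p hp hc]
      exact normWeight_nonneg hc _
    · simp only [weightedNorm_eq_norm s hs hK p hp hc]
      rw [normWeight_eq_zero hc, Algebra.norm_eq_zero_iff]
      simp
    · refine (divisionBound_iff s hs hK p hp hc 1).mpr fun ξ => ?_
      obtain ⟨x, y, rfl⟩ := exists_rat_coords s hs hK ξ
      obtain ⟨a, b, hab, hle⟩ := exists_normWeight_le_max (by linarith : 23 ≤ c) x y
      obtain ⟨q, hq⟩ := exists_translate s hs hK p hp hc x y a b hab
      refine ⟨q, hq ▸ lt_of_le_of_lt hle (max_lt ?_ limitMinimum_lt)⟩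
      rw [div_lt_one hc]
      exact hlt

theorem firstMinimum_le_max {c : ℝ} (hc : 23 ≤ c) :
    firstMinimum (weightedNorm (K := K) p c) ≤ ((max (25 / c) limitMinimum : ℝ) : EReal) :=
  firstMinimum_le s hs hK p hp (by linarith) (exists_normWeight_le_max hc)

theorem center_le_firstMinimum {c : ℝ} (hc : 0 < c) :
    ((25 / c : ℝ) : EReal) ≤ firstMinimum (weightedNorm (K := K) p c) :=
  le_firstMinimum s hs hK p hp hc (isCenter_basic.le_normWeight hc)

end Field

/-! ### The threshold and isolation -/

theorem limitMinimum_mul : limitMinimum * (23 / 15 * (8 + √69)) = 25 := by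
  unfold limitMinimum
  linear_combination 5 * sqrt69_sq

theorem div_le_limitMinimum {c : ℝ} (hc : 23 / 15 * (8 + √69) ≤ c) : 25 / c ≤ limitMinimum := by
  have h0 : 0 < 23 / 15 * (8 + √69) := by positivity
  rw [div_le_iff₀ (by linarith), ← limitMinimum_mul]
  exact mul_le_mul_of_nonneg_left hc (by linarith [limitMinimum_gt])

theorem limitMinimum_lt_div {c : ℝ} (hc : 0 < c) (hc' : c < 23 / 15 * (8 + √69)) :
    limitMinimum < 25 / c := by
  rw [lt_div_iff₀ hc, ← limitMinimum_mul]
  exact mul_lt_mul_of_pos_left hc' (by linarith [limitMinimum_gt])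

theorem threshold_gt : 25 < 23 / 15 * (8 + √69) := by
  have := sqrt69_gt; norm_num at *; linarith

section Field

variable {K : Type*} [Field K] [NumberField K]
variable (s : 𝓞 K) (hs : s ^ 2 = 69) (hK : IntermediateField.adjoin ℚ {(s : K)} = ⊤)
  (p : HeightOneSpectrum (𝓞 K)) (hp : p.asIdeal = Ideal.span {23, s})

include hs hK hp

theorem firstMinimum_of_threshold_le {c : ℝ} (hc : 23 / 15 * (8 + √69) ≤ c) :
    firstMinimum (weightedNorm (K := K) p c) = (limitMinimum : EReal) := by
  have h25 := threshold_gt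
  apply le_antisymm
  · have := firstMinimum_le_max s hs hK p hp (by linarith : 23 ≤ c)
    rwa [max_eq_right (div_le_limitMinimum hc)] at this
  · refine EReal.ge_of_forall_gt_iff_ge.mp fun κ hκ => ?_
    obtain ⟨x, y, -, h⟩ := exists_near_limitMinimum hc (by exact_mod_cast hκ)
    exact le_firstMinimum s hs hK p hp (by linarith) h

theorem firstMinimum_of_lt_threshold {c : ℝ} (hc : 23 ≤ c) (hc' : c < 23 / 15 * (8 + √69)) :
    firstMinimum (weightedNorm (K := K) p c) = ((25 / c : ℝ) : EReal) := by
  apply le_antisymm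
  · have := firstMinimum_le_max s hs hK p hp hc
    rwa [max_eq_left (limitMinimum_lt_div (by linarith) hc').le] at this
  · exact center_le_firstMinimum s hs hK p hp (by linarith)

theorem isIsolatedMinimum_of_lt_threshold {c : ℝ} (hc : 23 ≤ c)
    (hc' : c < 23 / 15 * (8 + √69)) : IsIsolatedMinimum (weightedNorm (K := K) p c) := by
  have hc0 : 0 < c := by linarith
  -- The centres attain `25/c` exactly; every other point has minimum at most `limitMinimum < 25/c`.
  refine ⟨limitMinimum, ?_, fun ξ hξ => ?_⟩
  · rw [firstMinimum_of_lt_threshold s hs hK p hp hc hc']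
    exact_mod_cast limitMinimum_lt_div hc0 hc'
  · obtain ⟨x, y, rfl⟩ := exists_rat_coords s hs hK ξ
    by_cases hcen : IsCenter x y
    · refine absurd ?_ hξ
      rw [firstMinimum_of_lt_threshold s hs hK p hp hc hc']
      apply le_antisymm
      · obtain ⟨a, b, hab, he⟩ := hcen.exists_normWeight_eq hc0
        exact pointMinimum_translate_le s hs hK p hp hc0 ⟨a, b, hab, he.le⟩
      · exact le_pointMinimum_of_translates s hs hK p hp hc0 (hcen.le_normWeight hc0)
    · obtain ⟨a, b, hab, he⟩ := exists_normWeight_lt_of_not_center hc x y hcen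
      exact pointMinimum_translate_le s hs hK p hp hc0 ⟨a, b, hab, he.le⟩

theorem not_isIsolatedMinimum_of_threshold_le {c : ℝ} (hc : 23 / 15 * (8 + √69) ≤ c) :
    ¬ IsIsolatedMinimum (weightedNorm (K := K) p c) := by
  rintro ⟨κ, hκ, h⟩
  have h25 := threshold_gt
  have hc0 : 0 < c := by linarith
  rw [firstMinimum_of_threshold_le s hs hK p hp hc] at hκ h
  obtain ⟨κ', h1, h2⟩ := exists_between (EReal.coe_lt_coe_iff.mp hκ)
  obtain ⟨x, y, hy, hxy⟩ := exists_near_limitMinimum hc h2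
  -- The approximating point is not a centre, so its minimum is strictly below `M₁` although it
  -- exceeds `κ`.
  obtain ⟨a, b, hab, he⟩ := exists_normWeight_lt_of_not_center (by linarith : 23 ≤ c) x y
    (not_isCenter hy)
  have h3 : pointMinimum (weightedNorm p c) ((x : K) + y * (s : K)) < (limitMinimum : EReal) :=
    lt_of_le_of_lt (pointMinimum_translate_le s hs hK p hp hc0 ⟨a, b, hab, le_rfl⟩)
      (EReal.coe_lt_coe_iff.mpr he)
  have h4 := (le_pointMinimum_of_translates s hs hK p hp hc0 hxy).trans (h _ h3.ne)
  exact absurd (EReal.coe_le_coe_iff.mp h4) (not_le.mpr h1)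

theorem not_isIsolatedMinimum_of_lt {c : ℝ} (hc : 0 < c) (hc' : c < 23) :
    ¬ IsIsolatedMinimum (weightedNorm (K := K) p c) := by
  rintro ⟨κ, hκ, h⟩
  obtain ⟨x, y, hxy⟩ := exists_large_of_lt hc hc' (κ + 1)
  have h1 := le_pointMinimum_of_translates s hs hK p hp hc hxy
  have h2 : firstMinimum (weightedNorm (K := K) p c) = ⊤ := by
    refine EReal.eq_top_iff_forall_lt _ |>.mpr fun M => ?_
    obtain ⟨x, y, hxy⟩ := exists_large_of_lt hc hc' (M + 1)
    refine lt_of_lt_of_le ?_ (le_firstMinimum s hs hK p hp hc hxy)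
    exact_mod_cast lt_add_one M
  -- A single translate already bounds the minimum at a point, so it never equals `M₁ = ⊤`.
  have h3 : pointMinimum (weightedNorm p c) ((x : K) + y * (s : K)) ≠ ⊤ := by
    refine ne_top_of_le_ne_top (EReal.coe_ne_top _)
      (pointMinimum_translate_le s hs hK p hp hc ⟨0, 0, by norm_num, le_rfl⟩)
  have h4 := h1.trans (h _ (by rw [h2]; exact h3))
  have := EReal.coe_le_coe_iff.mp h4
  linarith

end Field

end EuclideanWindows

end

theorem mainTheorem2 {K : Type*} [Field K] [NumberField K] (s : 𝓞 K) (hs : s ^ 2 = 69)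
    (hK : IntermediateField.adjoin ℚ {(s : K)} = ⊤)
    (p : IsDedekindDomain.HeightOneSpectrum (𝓞 K)) (hp : p.asIdeal = Ideal.span {23, s}) :
    EuclideanWindows.euclideanWindow p = Set.Ioi 25 ∧
    (∀ c ∈ EuclideanWindows.euclideanWindow p,
      EuclideanWindows.firstMinimum (EuclideanWindows.weightedNorm p c) =
        ((max (25 / c) (1 / 23 * (-600 + 75 * Real.sqrt 69)) : ℝ) : EReal)) ∧
    (∀ c : ℝ, 23 / 15 * (8 + Real.sqrt 69) ≤ c → ∃ x : ℝ, Irrational x ∧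
      EuclideanWindows.firstMinimum (EuclideanWindows.weightedNorm p c) = (x : EReal)) ∧
    (∀ c : ℝ, 0 < c →
      (EuclideanWindows.IsIsolatedMinimum (EuclideanWindows.weightedNorm p c) ↔
        c ∈ Set.Ico 23 (23 / 15 * (8 + Real.sqrt 69)))) := by
  have hw := EuclideanWindows.euclideanWindow_eq s hs hK p hp
  refine ⟨hw, fun c hc => ?_, fun c hc => ?_, fun c hc => ⟨fun h => ?_, fun h => ?_⟩⟩
  · rw [hw] at hc
    have hc : 25 < c := hc
    change _ = ((max (25 / c) EuclideanWindows.limitMinimum : ℝ) : EReal)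
    rcases lt_or_ge c (23 / 15 * (8 + Real.sqrt 69)) with h | h
    · rw [EuclideanWindows.firstMinimum_of_lt_threshold s hs hK p hp (by linarith) h,
        max_eq_left (EuclideanWindows.limitMinimum_lt_div (by linarith) h).le]
    · rw [EuclideanWindows.firstMinimum_of_threshold_le s hs hK p hp h,
        max_eq_right (EuclideanWindows.div_le_limitMinimum h)]
  · exact ⟨_, EuclideanWindows.irrational_limitMinimum,
      EuclideanWindows.firstMinimum_of_threshold_le s hs hK p hp hc⟩
  · by_contra hn
    rw [Set.mem_Ico, not_and_or, not_le, not_lt] at hn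
    rcases hn with hn | hn
    · exact EuclideanWindows.not_isIsolatedMinimum_of_lt s hs hK p hp hc hn h
    · exact EuclideanWindows.not_isIsolatedMinimum_of_threshold_le s hs hK p hp hn h
  · exact EuclideanWindows.isIsolatedMinimum_of_lt_threshold s hs hK p hp h.1 h.2
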